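/- **Theorem.** Consider quantum circuits on $n$ qubits of depth $D$: $D$ layers $U_1,\dots,U_D$, each a tensor product of one- and two-qubit unitary gates acting on disjoint sets of qubits, applied to $|0\rangle^{\otimes n}$. The output state is $\psi=|\psi\rangle\langle\psi|$ with $|\psi\rangle=U_D\cdots U_1|0\rangle^{\otimes n}$. Consider three scenarios, with a number $k=k(D)$ in each: 1. $k=2^D$, if the gates are not geometrically local (two-qubit gates may act on any pairs of qubits); 2. $k=2D$, if the qubits can be placed at distinct sites of a one-dimensional chain so that every two-qubit gate acts on neighbouring sites; 3. $k=\gamma_2(D)$, if the qubits can be placed at distinct sites of the square lattice $\mathbb Z^2$ so that every two-qubit gate acts on neighbouring sites. Here $\gamma_2(D)$ is the largest cardinality of a set obtained from $\{(0,0)\}$ in $D$ steps, where in each step every point of the current set may add at most one of its lattice neighbours. In a random Pauli measurement of a copy of $\psi$, each qubit is measured in a basis chosen independently and uniformly at random from the eigenbases of $\sigma_X,\sigma_Y,\sigma_Z$; the chosen bases and the outcomes are recorded. A tomography procedure on $N$ copies maps the records of the random Pauli measurements of $N$ independent copies to a density matrix $\hat\rho$; it *succeeds with precision $\varepsilon$*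 on $\psi$ if $\|\hat\rho-\psi\|_1<\varepsilon$ (trace norm) with probability at least $2/3$. There is an absolute constant $C>0$ such that in each of the three scenarios, for all $n,D$ and all $\varepsilon>0$: (i) (unknown circuit structure) if $k<n$ and $$N\ \ge\ C\,\frac{n^2\,10^{k}\,\log\binom{n}{k}}{\varepsilon^4},$$ then there is a single tomography procedure on $N$ copies that succeeds with precision $\varepsilon$ on the output states of all depth-$D$ circuits of the scenario; (ii) (known circuit structure) if $n\ge 2$ and $$N\ \ge\ C\,\frac{n^2\,10^{k}\,\log n}{\varepsilon^4},$$ then for every circuit structure of depth $D$ of the scenario (that is, the specification, for each layer, of the sets of qubits on which its gates act) there is a tomography procedure on $N$ copies that succeeds with precision $\varepsilon$ on the output states of all circuits with that structure, whatever their gates. -/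

import Mathlib

open scoped ComplexOrder

noncomputable section

namespace ShallowTomography

/-! ### Qubits, states, trace norm -/

/-- Computational basis labels of an `n`-qubit register. -/
abbrev Bits (n : ℕ) : Type := Fin n → Fin 2

/-- Operators on the state space of `n` qubits, as matrices in the computational basis. -/
abbrev Op (n : ℕ) : Type := Matrix (Bits n) (Bits n) ℂ

/-- Density operators. -/
def IsState {n : ℕ} (ρ : Op n) : Prop := ρ.PosSemidef ∧ ρ.trace = 1

/-- The trace norm `‖A‖₁ = Tr √(A† A)`, the sum of the singular values of `A`. -/
def traceNorm {n : ℕ} (A : Op n) : ℝ :=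
  ∑ i, √((Matrix.isHermitian_conjTranspose_mul_self A).eigenvalues i)

/-! ### Circuits -/

/-- The structure of a depth-`D` circuit: for each of the `D` layers, the sets of qubits on which
the gates of that layer act. Every gate acts on two qubits (one-qubit gates are allowed as well),
and the gates of one layer act on disjoint sets of qubits. -/
structure CircuitStructure (n D : ℕ) where
  layer : Fin D → Finset (Finset (Fin n))
  card_gate : ∀ t, ∀ s ∈ layer t, s.card = 1 ∨ s.card = 2
  disjoint_gates : ∀ t, (layer t : Set (Finset (Fin n))).PairwiseDisjoint id

/-- A choice of unitary matrices for all possible gate locations in `D` layers (only the entries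
at the gate locations of a circuit structure are used). -/
abbrev Gates (n D : ℕ) : Type :=
  Fin D → (s : Finset (Fin n)) → Matrix.unitaryGroup (s → Fin 2) ℂ

/-- The tensor product of the gates `V s`, for `s ∈ L`, and of the identity on all qubits that lie
in no `s ∈ L`. -/
def layerMatrix {n : ℕ} (L : Finset (Finset (Fin n)))
    (V : (s : Finset (Fin n)) → Matrix.unitaryGroup (s → Fin 2) ℂ) : Op n :=
  Matrix.of fun x y =>
    (∏ s ∈ L, (V s : Matrix (s → Fin 2) (s → Fin 2) ℂ) (fun i => x i) (fun i => y i)) *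
      (if ∀ i, (∀ s ∈ L, i ∉ s) → x i = y i then 1 else 0)

/-- The output vector `U_D ⋯ U_1 |0⟩^{⊗ n}` of a circuit. -/
def outputVector {n D : ℕ} (S : CircuitStructure n D) (V : Gates n D) : Bits n → ℂ :=
  Fin.foldl D (fun v t => (layerMatrix (S.layer t) (V t)).mulVec v) (Pi.single (fun _ => 0) 1)

/-- The output state `|ψ⟩⟨ψ|` of a circuit. -/
def outputState {n D : ℕ} (S : CircuitStructure n D) (V : Gates n D) : Op n :=
  Matrix.vecMulVec (outputVector S V) (star (outputVector S V))

/-! ### Geometric locality -/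

/-- Neighbouring points of the square lattice. -/
def LatticeAdj (p q : ℤ × ℤ) : Prop := |p.1 - q.1| + |p.2 - q.2| = 1

/-- The point sets obtained from `{(0,0)}` in `D` steps, where in each step every point of the
current set may add at most one of its neighbours (`f p = p` when `p` adds nothing). -/
def latticeGrowth : ℕ → Set (Finset (ℤ × ℤ))
  | 0 => {{(0, 0)}}
  | D + 1 => {T | ∃ S ∈ latticeGrowth D, ∃ f : ℤ × ℤ → ℤ × ℤ,
      (∀ p ∈ S, f p = p ∨ LatticeAdj p (f p)) ∧ T = S ∪ S.image f}

/-- The largest cardinality of a set in `latticeGrowth D`. -/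
def gammaTwo (D : ℕ) : ℕ := sSup (Finset.card '' latticeGrowth D)

/-- The cardinalities in the definition of `gammaTwo` are bounded, so `sSup` is their maximum. -/
theorem card_le_of_mem_latticeGrowth (D : ℕ) : ∀ S ∈ latticeGrowth D, S.card ≤ 2 ^ D := by
  induction D with
  | zero =>
    intro S hS
    simp only [latticeGrowth, Set.mem_singleton_iff] at hS
    simp [hS]
  | succ D ih =>
    rintro T ⟨S, hS, f, -, rfl⟩
    have h1 := ih S hS
    have h2 := Finset.card_union_le S (S.image f)
    have h3 := Finset.card_image_le (s := S) (f := f)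
    rw [pow_succ]
    omega

/-- The three scenarios: no geometric locality, a one-dimensional chain, the square lattice. -/
inductive Geometry where
  | general
  | chain
  | square

/-- The value of `k` in each scenario. -/
def Geometry.locality : Geometry → ℕ → ℕ
  | general, D => 2 ^ D
  | chain, D => 2 * D
  | square, D => gammaTwo D

/-- The circuit structure is local for the geometry: the qubits can be placed at distinct sites so
that every two-qubit gate acts on qubits at neighbouring sites. -/
def CircuitStructure.IsLocal {n D : ℕ} (S : CircuitStructure n D) : Geometry → Prop
  | .general => True
  | .chain => ∃ pos : Fin n → ℤ, Function.Injective pos ∧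
      ∀ t, ∀ s ∈ S.layer t, ∀ i ∈ s, ∀ j ∈ s, i ≠ j → |pos i - pos j| = 1
  | .square => ∃ pos : Fin n → ℤ × ℤ, Function.Injective pos ∧
      ∀ t, ∀ s ∈ S.layer t, ∀ i ∈ s, ∀ j ∈ s, i ≠ j → LatticeAdj (pos i) (pos j)

/-! ### Random Pauli measurements -/

/-- The Pauli matrices `σ_X`, `σ_Y`, `σ_Z`. -/
def pauli : Fin 3 → Matrix (Fin 2) (Fin 2) ℂ :=
  ![!![0, 1; 1, 0], !![0, -Complex.I; Complex.I, 0], !![1, 0; 0, -1]]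

/-- The projector onto the eigenspace of `pauli a` for the eigenvalue `(-1) ^ b`. -/
def pauliProj (a : Fin 3) (b : Fin 2) : Matrix (Fin 2) (Fin 2) ℂ :=
  (1 / 2 : ℂ) • (1 + (-1 : ℂ) ^ (b : ℕ) • pauli a)

/-- The record of one measured copy: the Pauli basis chosen for each qubit, and the outcomes. -/
abbrev Record (n : ℕ) : Type := (Fin n → Fin 3) × (Fin n → Fin 2)

/-- The projector `⊗ᵢ pauliProj (r.1 i) (r.2 i)` of the outcome string `r.2` when the `i`-th qubit is
measured in the basis `r.1 i`. -/
def recordProj {n : ℕ} (r : Record n) : Op n :=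
  Matrix.of fun x y => ∏ i, pauliProj (r.1 i) (r.2 i) (x i) (y i)

/-- The probability of the record `r` when one copy of `ρ` is measured qubit by qubit, each qubit
in an independent and uniformly random one of the three Pauli bases (Born's rule). -/
def recordProb {n : ℕ} (ρ : Op n) (r : Record n) : ℝ :=
  (1 / 3) ^ n * (ρ * recordProj r).trace.re

/-- A tomography procedure: it maps the records of `N` measured copies to a state. -/
structure Learner (n N : ℕ) where
  estimate : (Fin N → Record n) → Op n
  isState_estimate : ∀ ω, IsState (estimate ω)

open Classical in
/-- The probability that the estimate from random Pauli measurements of `N` independent copies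
of `ρ` is within `ε` of `ρ` in trace norm. -/
def successProb {n N : ℕ} (A : Learner n N) (ρ : Op n) (ε : ℝ) : ℝ :=
  ∑ ω : Fin N → Record n with traceNorm (A.estimate ω - ρ) < ε, ∏ t, recordProb ρ (ω t)

end ShallowTomography

end

noncomputable section

namespace ShallowTomography

/-! ### Concentration of sums of bounded independent vectors -/

/-! The output state of a shallow circuit is pinned down by few-body marginals. Write `U` for the
circuit and conjugate by it the projector onto `|1⟩` of qubit `i`. The resulting `parentTerm` acts
only on the light cone of `i`, because gates outside the cone cancel
(`SupportedOn.conj_layerMatrix`), and the cone has at most `k` qubits (`card_lightCone_le`). All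
these terms have expectation zero in the output state, while their sum dominates the projector onto
its orthogonal complement. So for any state `ρ` the infidelity is at most the sum of the
expectations of the terms in `ρ` (`one_sub_fidelity_le`), each of which sees only the difference of
the marginals of `ρ` and of the output state. A term has Hilbert–Schmidt norm at most `2^(k/2)` on
its cone, so marginals known up to `δ` give infidelity at most `n δ 2^(k/2)`, and Fuchs–van de Graaf
turns this into trace distance (`traceNorm_sub_outputState_le`).

It remains to learn marginals in Hilbert–Schmidt norm with `δ` of order `ε² / (n 2^(k/2))`. The
classical shadow of a record on `k` qubits is an unbiased estimator of norm exactly `5^(k/2)`, and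
averages of independent bounded vectors in a Hilbert space concentrate without a dimension factor
(`sum_filter_lt_norm_le`). Hence order `5^k log m / δ²`, that is `n² 10^k log m / ε⁴`, copies
suffice for `m` marginals at once.

The learner never reconstructs the circuit: it returns any state compatible with the empirical
marginals. For known structure the sets are the `n` light cones; for unknown structure they are all
`k`-subsets. -/

theorem sum_fin_succ_pi {R M : Type*} [Fintype R] [AddCommMonoid M] {N : ℕ}
    (G : (Fin (N + 1) → R) → M) :
    ∑ ω, G ω = ∑ r, ∑ ω : Fin N → R, G (Fin.cons r ω) := by
  rw [← (Fin.consEquiv (fun _ => R)).sum_comp, Fintype.sum_prod_type]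
  rfl

theorem sum_prod_eq_one {R : Type*} [Fintype R] {p : R → ℝ} (hp1 : ∑ r, p r = 1) (N : ℕ) :
    ∑ ω : Fin N → R, ∏ t, p (ω t) = 1 := by
  have h := Finset.prod_univ_sum (fun _ : Fin N => (Finset.univ : Finset R)) (fun _ r => p r)
  simpa [hp1] using h.symm

/-- A centred random variable with values in `[-c, c]` is sub-Gaussian. -/
theorem sum_mul_exp_le {R : Type*} [Fintype R] {p : R → ℝ} (hp : ∀ r, 0 ≤ p r)
    (hp1 : ∑ r, p r = 1) {z : R → ℝ} {c : ℝ} (hz : ∀ r, |z r| ≤ c) (h0 : ∑ r, p r * z r = 0) :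
    ∑ r, p r * Real.exp (z r) ≤ Real.exp (c ^ 2 / 2) := by
  -- By convexity `exp` lies below its chord over `[-c, c]`. For `c = 0` the quotient takes the
  -- default value `0`, and both sides equal `1`.
  have key : ∀ r, Real.exp (z r) ≤ Real.cosh c + z r * (Real.sinh c / c) := by
    intro r
    have hr := abs_le.1 (hz r)
    rcases (abs_nonneg (z r)).trans (hz r) |>.eq_or_lt with hc | hc
    · have : z r = 0 := by linarith [hr.1, hr.2]
      simp [← hc, this]
    · have hcv : ConvexOn ℝ Set.univ Real.exp := convexOn_exp
      have ha : 0 ≤ (c - z r) / (2 * c) := div_nonneg (by linarith [hr.2]) (by linarith)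
      have hb : 0 ≤ (c + z r) / (2 * c) := div_nonneg (by linarith [hr.1]) (by linarith)
      have h := hcv.2 (Set.mem_univ (-c)) (Set.mem_univ c) ha hb (by field_simp; ring)
      have e : ((c - z r) / (2 * c)) • (-c) + ((c + z r) / (2 * c)) • c = z r := by
        simp only [smul_eq_mul]; field_simp; ring
      rw [e] at h
      refine h.trans (le_of_eq ?_)
      rw [Real.cosh_eq, Real.sinh_eq]
      simp only [smul_eq_mul]
      field_simp
      ring
  calc ∑ r, p r * Real.exp (z r)
      ≤ ∑ r, p r * (Real.cosh c + z r * (Real.sinh c / c)) :=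
        Finset.sum_le_sum fun r _ => mul_le_mul_of_nonneg_left (key r) (hp r)
    _ = (∑ r, p r) * Real.cosh c + (∑ r, p r * z r) * (Real.sinh c / c) := by
        rw [Finset.sum_mul, Finset.sum_mul, ← Finset.sum_add_distrib]
        exact Finset.sum_congr rfl fun r _ => by ring
    _ = Real.cosh c := by rw [hp1, h0]; ring
    _ ≤ _ := Real.cosh_le_exp_half_sq c

section Vector

variable {R H : Type*} [Fintype R] [NormedAddCommGroup H]

/-- The expected norm of `x + ∑ t, Y (ω t)` for independent `ω t` distributed according to `p`. -/
def meanNorm (p : R → ℝ) (Y : R → H) (N : ℕ) (x : H) : ℝ :=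
  ∑ ω : Fin N → R, (∏ t, p (ω t)) * ‖x + ∑ t, Y (ω t)‖

theorem meanNorm_succ (p : R → ℝ) (Y : R → H) (N : ℕ) (x : H) :
    meanNorm p Y (N + 1) x = ∑ r, p r * meanNorm p Y N (x + Y r) := by
  simp only [meanNorm, sum_fin_succ_pi, Fin.prod_univ_succ, Fin.sum_univ_succ, Fin.cons_zero,
    Fin.cons_succ, Finset.mul_sum, mul_assoc, add_assoc]

theorem abs_meanNorm_sub_le {p : R → ℝ} (hp : ∀ r, 0 ≤ p r) (hp1 : ∑ r, p r = 1) (Y : R → H)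
    (N : ℕ) (x y : H) : |meanNorm p Y N x - meanNorm p Y N y| ≤ ‖x - y‖ := by
  rw [meanNorm, meanNorm, ← Finset.sum_sub_distrib]
  refine (Finset.abs_sum_le_sum_abs _ _).trans ?_
  calc _ ≤ ∑ ω : Fin N → R, (∏ t, p (ω t)) * ‖x - y‖ := by
        refine Finset.sum_le_sum fun ω _ => ?_
        have h0 : 0 ≤ ∏ t, p (ω t) := Finset.prod_nonneg fun t _ => hp _
        rw [← mul_sub, abs_mul, abs_of_nonneg h0]
        refine mul_le_mul_of_nonneg_left ((abs_norm_sub_norm_le _ _).trans (le_of_eq ?_)) h0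
        congr 1
        abel
    _ = ‖x - y‖ := by rw [← Finset.sum_mul, sum_prod_eq_one hp1, one_mul]

/-- Doob martingale argument: `meanNorm` is 1-Lipschitz in its starting point, so revealing one
sample moves the conditional mean by at most the diameter `c` of the values of `Y`, and costs a
factor `exp ((l c)² / 2)`. The starting point is universally quantified so that the induction can
absorb the first sample into it. -/
theorem sum_exp_norm_sub_meanNorm_le {p : R → ℝ} (hp : ∀ r, 0 ≤ p r) (hp1 : ∑ r, p r = 1)
    {Y : R → H} {c : ℝ} (hY : ∀ r r', ‖Y r - Y r'‖ ≤ c) {l : ℝ} (hl : 0 ≤ l) (N : ℕ) :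
    ∀ x : H, ∑ ω : Fin N → R, (∏ t, p (ω t)) *
      Real.exp (l * (‖x + ∑ t, Y (ω t)‖ - meanNorm p Y N x)) ≤
        Real.exp (N * ((l * c) ^ 2 / 2)) := by
  induction N with
  | zero => intro x; simp [meanNorm]
  | succ N ih =>
    intro x
    have hstep : ∀ r, |l * (meanNorm p Y N (x + Y r) - meanNorm p Y (N + 1) x)| ≤ l * c := by
      intro r
      rw [abs_mul, abs_of_nonneg hl]
      refine mul_le_mul_of_nonneg_left ?_ hl
      -- The increment is an average over an independent copy `r'` of the revealed sample.
      have e : meanNorm p Y N (x + Y r) - meanNorm p Y (N + 1) x =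
          ∑ r', p r' * (meanNorm p Y N (x + Y r) - meanNorm p Y N (x + Y r')) := by
        simp only [mul_sub, Finset.sum_sub_distrib, ← Finset.sum_mul, hp1, one_mul, meanNorm_succ]
      rw [e]
      refine (Finset.abs_sum_le_sum_abs _ _).trans ?_
      calc _ ≤ ∑ r', p r' * c := by
            refine Finset.sum_le_sum fun r' _ => ?_
            rw [abs_mul, abs_of_nonneg (hp r')]
            refine mul_le_mul_of_nonneg_left
              ((abs_meanNorm_sub_le hp hp1 Y N _ _).trans ?_) (hp r')
            rw [add_sub_add_left_eq_sub]
            exact hY r r'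
        _ = c := by rw [← Finset.sum_mul, hp1, one_mul]
    have hmean : ∑ r, p r * (l * (meanNorm p Y N (x + Y r) - meanNorm p Y (N + 1) x)) = 0 := by
      have : ∑ r, p r * (l * (meanNorm p Y N (x + Y r) - meanNorm p Y (N + 1) x)) =
          l * ((∑ r, p r * meanNorm p Y N (x + Y r)) - (∑ r, p r) * meanNorm p Y (N + 1) x) := by
        rw [Finset.sum_mul, ← Finset.sum_sub_distrib, Finset.mul_sum]
        exact Finset.sum_congr rfl fun r _ => by ring
      rw [this, hp1, meanNorm_succ]
      ring
    calc _ = ∑ r, (p r * Real.exp (l * (meanNorm p Y N (x + Y r) - meanNorm p Y (N + 1) x))) *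
          ∑ ω : Fin N → R, (∏ t, p (ω t)) *
            Real.exp (l * (‖(x + Y r) + ∑ t, Y (ω t)‖ - meanNorm p Y N (x + Y r))) := by
          rw [sum_fin_succ_pi]
          refine Finset.sum_congr rfl fun r _ => ?_
          rw [Finset.mul_sum]
          refine Finset.sum_congr rfl fun ω _ => ?_
          rw [mul_mul_mul_comm, ← Real.exp_add]
          simp only [Fin.prod_univ_succ, Fin.sum_univ_succ, Fin.cons_zero, Fin.cons_succ,
            add_assoc]
          congr 2
          ring
      _ ≤ ∑ r, (p r * Real.exp (l * (meanNorm p Y N (x + Y r) - meanNorm p Y (N + 1) x))) *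
          Real.exp (N * ((l * c) ^ 2 / 2)) :=
          Finset.sum_le_sum fun r _ => mul_le_mul_of_nonneg_left (ih _)
            (mul_nonneg (hp r) (Real.exp_pos _).le)
      _ ≤ Real.exp ((l * c) ^ 2 / 2) * Real.exp (N * ((l * c) ^ 2 / 2)) := by
          rw [← Finset.sum_mul]
          exact mul_le_mul_of_nonneg_right (sum_mul_exp_le hp hp1 hstep hmean)
            (Real.exp_pos _).le
      _ = _ := by
          rw [← Real.exp_add]
          push_cast
          congr 1
          ring

variable [InnerProductSpace ℂ H]

/-- The cross terms vanish because `Y` is centred; this is where the inner product is needed. -/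
theorem sum_norm_sq_le {p : R → ℝ} (hp : ∀ r, 0 ≤ p r) (hp1 : ∑ r, p r = 1)
    {Y : R → H} {c : ℝ} (hY : ∀ r, ‖Y r‖ ≤ c) (h0 : ∑ r, (p r : ℂ) • Y r = 0) (N : ℕ) :
    ∀ x : H, ∑ ω : Fin N → R, (∏ t, p (ω t)) * ‖x + ∑ t, Y (ω t)‖ ^ 2 ≤
      ‖x‖ ^ 2 + N * c ^ 2 := by
  induction N with
  | zero => intro x; simp
  | succ N ih =>
    intro x
    have hcross : ∑ r, p r * RCLike.re (inner ℂ x (Y r)) = 0 := by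
      have h := congrArg (fun v => RCLike.re (inner ℂ x v)) h0
      simp only [inner_sum, inner_smul_right, map_sum, inner_zero_right, map_zero] at h
      rw [← h]
      exact Finset.sum_congr rfl fun r _ => by simp
    calc _ = ∑ r, p r * ∑ ω : Fin N → R, (∏ t, p (ω t)) * ‖(x + Y r) + ∑ t, Y (ω t)‖ ^ 2 := by
          rw [sum_fin_succ_pi]
          simp only [Fin.prod_univ_succ, Fin.sum_univ_succ, Fin.cons_zero, Fin.cons_succ,
            Finset.mul_sum, mul_assoc, add_assoc]
      _ ≤ ∑ r, p r * (‖x‖ ^ 2 + 2 * RCLike.re (inner ℂ x (Y r)) + c ^ 2 + N * c ^ 2) := by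
          refine Finset.sum_le_sum fun r _ => mul_le_mul_of_nonneg_left ((ih _).trans ?_) (hp r)
          rw [@norm_add_sq ℂ]
          have := pow_le_pow_left₀ (norm_nonneg _) (hY r) 2
          linarith
      _ = (∑ r, p r) * (‖x‖ ^ 2 + c ^ 2 + N * c ^ 2) +
            2 * ∑ r, p r * RCLike.re (inner ℂ x (Y r)) := by
          rw [Finset.sum_mul, Finset.mul_sum, ← Finset.sum_add_distrib]
          exact Finset.sum_congr rfl fun r _ => by ring
      _ = _ := by
          rw [hp1, hcross]
          push_cast
          ring

theorem meanNorm_zero_le {p : R → ℝ} (hp : ∀ r, 0 ≤ p r) (hp1 : ∑ r, p r = 1)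
    {Y : R → H} {c : ℝ} (hY : ∀ r, ‖Y r‖ ≤ c) (h0 : ∑ r, (p r : ℂ) • Y r = 0) (N : ℕ) :
    meanNorm p Y N 0 ≤ √(N * c ^ 2) := by
  refine Real.le_sqrt_of_sq_le ?_
  have hcs := Finset.sum_sq_le_sum_mul_sum_of_sq_le_mul (Finset.univ : Finset (Fin N → R))
    (r := fun ω => (∏ t, p (ω t)) * ‖(0 : H) + ∑ t, Y (ω t)‖)
    (f := fun ω => ∏ t, p (ω t)) (g := fun ω => (∏ t, p (ω t)) * ‖(0 : H) + ∑ t, Y (ω t)‖ ^ 2)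
    (fun ω _ => Finset.prod_nonneg fun t _ => hp _)
    (fun ω _ => mul_nonneg (Finset.prod_nonneg fun t _ => hp _) (sq_nonneg _))
    (fun ω _ => le_of_eq (by ring))
  rw [sum_prod_eq_one hp1, one_mul] at hcs
  refine hcs.trans ((sum_norm_sq_le hp hp1 hY h0 N 0).trans (le_of_eq ?_))
  simp

open Classical in
/-- Tail bound for the norm of a sum of independent bounded centred vectors. -/
theorem sum_filter_lt_norm_le {p : R → ℝ} (hp : ∀ r, 0 ≤ p r) (hp1 : ∑ r, p r = 1)
    {Y : R → H} {c : ℝ} (hc : 0 < c) (hY : ∀ r, ‖Y r‖ ≤ c)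
    (hY2 : ∀ r r', ‖Y r - Y r'‖ ≤ c) (h0 : ∑ r, (p r : ℂ) • Y r = 0)
    {N : ℕ} (hN : 0 < N) {s : ℝ} (hs : 0 ≤ s) :
    ∑ ω : Fin N → R with √(N * c ^ 2) + s < ‖∑ t, Y (ω t)‖, ∏ t, p (ω t) ≤
      Real.exp (-(s ^ 2 / (2 * (N * c ^ 2)))) := by
  have hNc : 0 < (N : ℝ) * c ^ 2 := by positivity
  -- The minimiser of the Chernoff exponent `-l s + N (l c)² / 2`.
  set l : ℝ := s / (N * c ^ 2) with hl
  have hl0 : 0 ≤ l := by positivity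
  have hexp := sum_exp_norm_sub_meanNorm_le hp hp1 hY2 hl0 N (0 : H)
  have hmean := meanNorm_zero_le hp hp1 hY h0 N
  calc _ ≤ ∑ ω : Fin N → R with √(N * c ^ 2) + s < ‖∑ t, Y (ω t)‖, (∏ t, p (ω t)) *
        (Real.exp (-(l * s)) *
          Real.exp (l * (‖(0 : H) + ∑ t, Y (ω t)‖ - meanNorm p Y N 0))) := by
        refine Finset.sum_le_sum fun ω hω => ?_
        refine le_mul_of_one_le_right (Finset.prod_nonneg fun t _ => hp _) ?_
        rw [← Real.exp_add, zero_add]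
        refine Real.one_le_exp ?_
        have h := (Finset.mem_filter.1 hω).2
        have : 0 ≤ l * (‖∑ t, Y (ω t)‖ - meanNorm p Y N 0 - s) :=
          mul_nonneg hl0 (by linarith)
        linarith
    _ ≤ ∑ ω : Fin N → R, (∏ t, p (ω t)) *
        (Real.exp (-(l * s)) *
          Real.exp (l * (‖(0 : H) + ∑ t, Y (ω t)‖ - meanNorm p Y N 0))) :=
        Finset.sum_le_sum_of_subset_of_nonneg (Finset.filter_subset _ _) fun ω _ _ =>
          mul_nonneg (Finset.prod_nonneg fun t _ => hp _) (by positivity)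
    _ ≤ Real.exp (-(l * s)) * Real.exp (N * ((l * c) ^ 2 / 2)) := by
        refine le_trans (le_of_eq ?_) (mul_le_mul_of_nonneg_left hexp (Real.exp_pos _).le)
        rw [Finset.mul_sum]
        exact Finset.sum_congr rfl fun ω _ => by ring
    _ = _ := by
        rw [← Real.exp_add, hl]
        congr 1
        field_simp
        ring

end Vector

/-! ### Trace distance to a pure state -/

/-- Diagonalising `A` shows that the characteristic polynomial of `Aᴴ A` has the squared eigenvalues
of `A` as roots. Only the multisets are compared, since the two enumerations of eigenvalues need not
match index by index. -/
theorem sum_eigenvalues_conjTranspose_mul_self {m : Type*} [Fintype m] [DecidableEq m]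
    {A : Matrix m m ℂ} (hA : A.IsHermitian) (f : ℝ → ℝ) :
    ∑ i, f ((Matrix.isHermitian_conjTranspose_mul_self A).eigenvalues i) =
      ∑ i, f (hA.eigenvalues i ^ 2) := by
  have hchar : (A.conjTranspose * A).charpoly =
      ∏ i, (Polynomial.X - Polynomial.C (((hA.eigenvalues i ^ 2 : ℝ)) : ℂ)) := by
    rw [hA.eq]
    conv_lhs => rw [hA.spectral_theorem]
    rw [← map_mul, Unitary.conjStarAlgAut_apply, Matrix.charpoly_mul_comm, ← mul_assoc]
    simp [Matrix.charpoly_diagonal, sq]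
  have h1 := (Matrix.isHermitian_conjTranspose_mul_self A).roots_charpoly_eq_eigenvalues
  rw [hchar, Polynomial.roots_prod _ _ (Finset.prod_ne_zero_iff.2 fun i _ =>
    Polynomial.X_sub_C_ne_zero _)] at h1
  simp only [Polynomial.roots_X_sub_C, Multiset.bind_singleton] at h1
  have h2 := congrArg (fun s => (s.map (fun z : ℂ => f z.re)).sum) h1
  simpa [Multiset.map_map, Function.comp_def, ← Complex.ofReal_pow] using h2.symm

theorem traceNorm_of_isHermitian {n : ℕ} {A : Op n} (hA : A.IsHermitian) :
    traceNorm A = ∑ i, |hA.eigenvalues i| := by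
  rw [traceNorm, sum_eigenvalues_conjTranspose_mul_self hA (fun x => √x)]
  simp [Real.sqrt_sq_eq_abs]

/-- The classical comparison of the total variation distance with the Bhattacharyya
coefficient. -/
theorem sum_abs_sq_sub_sq_le {ι : Type*} [Fintype ι] {a b : ι → ℝ}
    (ha : ∑ i, a i ^ 2 = 1) (hb : ∑ i, b i ^ 2 = 1) :
    ∑ i, |a i ^ 2 - b i ^ 2| ≤ 2 * √(1 - (∑ i, a i * b i) ^ 2) := by
  have h := Real.sum_mul_le_sqrt_mul_sqrt Finset.univ (fun i => |a i - b i|) (fun i => |a i + b i|)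
  have h1 : ∑ i, |a i - b i| ^ 2 = 2 * (1 - ∑ i, a i * b i) := by
    simp only [sq_abs, sub_sq, Finset.sum_add_distrib, Finset.sum_sub_distrib, ha, hb, mul_assoc,
      ← Finset.mul_sum]
    ring
  have h2 : ∑ i, |a i + b i| ^ 2 = 2 * (1 + ∑ i, a i * b i) := by
    simp only [sq_abs, add_sq, Finset.sum_add_distrib, ha, hb, mul_assoc, ← Finset.mul_sum]
    ring
  have h3 : 0 ≤ ∑ i, |a i - b i| ^ 2 := Finset.sum_nonneg fun i _ => sq_nonneg _
  calc ∑ i, |a i ^ 2 - b i ^ 2| = ∑ i, |a i - b i| * |a i + b i| :=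
        Finset.sum_congr rfl fun i _ => by rw [← abs_mul]; congr 1; ring
    _ ≤ _ := h
    _ = √((2 * 2) * (1 - (∑ i, a i * b i) ^ 2)) := by
        rw [← Real.sqrt_mul h3, h1, h2]
        congr 1
        ring
    _ = _ := by
        rw [Real.sqrt_mul (by norm_num), Real.sqrt_mul_self (by norm_num)]

section PureState

variable {n : ℕ}

theorem isState_vecMulVec {v : Bits n → ℂ} (hv : star v ⬝ᵥ v = 1) :
    IsState (Matrix.vecMulVec v (star v)) :=
  ⟨Matrix.posSemidef_vecMulVec_self_star v, by
    rw [Matrix.trace_vecMulVec, dotProduct_comm, hv]⟩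

open scoped MatrixOrder Matrix.Norms.L2Operator in
theorem exists_eq_conjTranspose_mul_self {ρ : Op n} (hρ : ρ.PosSemidef) :
    ∃ B : Op n, ρ = B.conjTranspose * B :=
  CStarAlgebra.nonneg_iff_eq_star_mul_self.mp hρ.nonneg

/-- The Fuchs–van de Graaf inequality for a state and a pure state. -/
theorem traceNorm_sub_pure_le {ρ : Op n} (hρ : IsState ρ) {v : Bits n → ℂ}
    (hv : star v ⬝ᵥ v = 1) :
    traceNorm (ρ - Matrix.vecMulVec v (star v)) ≤ 2 * √(1 - (star v ⬝ᵥ (ρ.mulVec v)).re) := by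
  have hA : (ρ - Matrix.vecMulVec v (star v)).IsHermitian :=
    hρ.1.isHermitian.sub (Matrix.posSemidef_vecMulVec_self_star v).isHermitian
  obtain ⟨B, rfl⟩ := exists_eq_conjTranspose_mul_self hρ.1
  set w := hA.eigenvectorBasis with hw
  -- Measure both states in an eigenbasis of their difference: `a i ^ 2` and `b i ^ 2` are the
  -- outcome probabilities of `ρ` and of the pure state, and their differences are the eigenvalues.
  -- The trace norm thus becomes a classical distance of distributions.
  set b : Bits n → ℝ := fun i => ‖inner ℂ (w i) (WithLp.toLp 2 v)‖ with hb
  set a : Bits n → ℝ := fun i => ‖WithLp.toLp 2 (B.mulVec (w i))‖ with ha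
  have hnorm : ∀ u : Bits n → ℂ, ((‖WithLp.toLp 2 u‖ ^ 2 : ℝ) : ℂ) = star u ⬝ᵥ u := by
    intro u
    rw [EuclideanSpace.norm_sq_eq]
    simp [dotProduct, Complex.conj_mul']
  have hinner : ∀ i, inner ℂ (w i) (WithLp.toLp 2 v) = star (w i : Bits n → ℂ) ⬝ᵥ v := by
    intro i
    rw [EuclideanSpace.inner_eq_star_dotProduct, dotProduct_comm]
  have hBB : ∀ u : Bits n → ℂ, star u ⬝ᵥ ((B.conjTranspose * B).mulVec u) =
      star (B.mulVec u) ⬝ᵥ B.mulVec u := by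
    intro u
    rw [← Matrix.mulVec_mulVec, Matrix.dotProduct_mulVec, Matrix.star_mulVec]
  have hb1 : ∑ i, b i ^ 2 = 1 := by
    have h1 := w.sum_sq_norm_inner_right (WithLp.toLp 2 v)
    have h2 := hnorm v
    rw [hv] at h2
    rw [hb]
    simp only
    rw [h1]
    exact_mod_cast h2
  have ha1 : ∑ i, a i ^ 2 = 1 := by
    have h1 : (B.conjTranspose * B).trace = ∑ i, ((a i ^ 2 : ℝ) : ℂ) := by
      have h2 := LinearMap.trace_eq_sum_inner (Matrix.toEuclideanLin (B.conjTranspose * B)) w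
      have h3 : LinearMap.trace ℂ _ (Matrix.toEuclideanLin (B.conjTranspose * B)) =
          (B.conjTranspose * B).trace := Matrix.trace_toLin_eq _ (PiLp.basisFun 2 ℂ (Bits n))
      rw [← h3, h2]
      refine Finset.sum_congr rfl fun i _ => ?_
      rw [ha, hnorm, ← hBB, EuclideanSpace.inner_eq_star_dotProduct, dotProduct_comm]
      rfl
    rw [hρ.2] at h1
    exact_mod_cast h1.symm
  have heig : ∀ i, hA.eigenvalues i = a i ^ 2 - b i ^ 2 := by
    intro i
    have h1 : ((hA.eigenvalues i : ℝ) : ℂ) = ((a i ^ 2 - b i ^ 2 : ℝ) : ℂ) := by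
      have h2 := congrArg (fun u => star (w i : Bits n → ℂ) ⬝ᵥ u) (hA.mulVec_eigenvectorBasis i)
      have h3 : star (w i : Bits n → ℂ) ⬝ᵥ (w i : Bits n → ℂ) = 1 := by
        rw [← hnorm]
        have : ‖WithLp.toLp 2 ((w i : Bits n → ℂ))‖ = 1 := w.orthonormal.1 i
        rw [this]
        simp
      simp only [Matrix.sub_mulVec, dotProduct_sub, dotProduct_smul, ← hw] at h2
      rw [h3, hBB, ← hnorm, Matrix.vecMulVec_mulVec] at h2
      have h4 : ((b i ^ 2 : ℝ) : ℂ) = (star v ⬝ᵥ (w i : Bits n → ℂ)) *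
          (star (w i : Bits n → ℂ) ⬝ᵥ v) := by
        have h5 : b i = ‖star (w i : Bits n → ℂ) ⬝ᵥ v‖ := by rw [← hinner]
        rw [h5, Complex.ofReal_pow, ← Complex.conj_mul', starRingEnd_apply, Matrix.star_dotProduct,
          star_star, dotProduct_comm]
      rw [Complex.ofReal_sub, h4]
      rw [dotProduct_smul, op_smul_eq_mul, mul_comm] at h2
      rw [h2]
      simp
    exact_mod_cast h1
  -- The fidelity is `‖B v‖²`; expanding `v` in the eigenbasis and using the triangle inequality
  -- bounds it by the squared Bhattacharyya coefficient.
  have hF : (star v ⬝ᵥ ((B.conjTranspose * B).mulVec v)).re ≤ (∑ i, a i * b i) ^ 2 := by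
    rw [hBB, ← hnorm, Complex.ofReal_re]
    refine pow_le_pow_left₀ (norm_nonneg _) ?_ 2
    have h1 : WithLp.toLp 2 (B.mulVec v) =
        ∑ i, inner ℂ (w i) (WithLp.toLp 2 v) • WithLp.toLp 2 (B.mulVec (w i)) := by
      have h2 := congrArg (Matrix.toEuclideanLin B) (w.sum_repr' (WithLp.toLp 2 v))
      rw [map_sum] at h2
      simp only [map_smul] at h2
      exact h2.symm
    rw [h1]
    refine (norm_sum_le _ _).trans (Finset.sum_le_sum fun i _ => ?_)
    rw [norm_smul, mul_comm]
  rw [traceNorm_of_isHermitian hA]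
  simp only [heig]
  refine (sum_abs_sq_sub_sq_le ha1 hb1).trans ?_
  gcongr

end PureState

/-! ### Operators supported on a set of qubits -/

section Support

open scoped Kronecker

variable {n : ℕ}

/-- The tensor product of an operator on the qubits in `A` and of the identity. -/
def embed (A : Finset (Fin n)) (M : Matrix (A → Fin 2) (A → Fin 2) ℂ) : Op n :=
  Matrix.of fun x y => M (fun i => x i) (fun i => y i) * if ∀ i, i ∉ A → x i = y i then 1 else 0

theorem embed_eq_submatrix (A : Finset (Fin n)) (M : Matrix (A → Fin 2) (A → Fin 2) ℂ) :
    embed A M = (M ⊗ₖ (1 : Matrix ({i // i ∉ A} → Fin 2) ({i // i ∉ A} → Fin 2) ℂ)).submatrix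
      (Equiv.piEquivPiSubtypeProd (· ∈ A) fun _ => Fin 2)
      (Equiv.piEquivPiSubtypeProd (· ∈ A) fun _ => Fin 2) := by
  ext x y
  simp [embed, Matrix.one_apply, funext_iff]

theorem embed_mul (A : Finset (Fin n)) (M M' : Matrix (A → Fin 2) (A → Fin 2) ℂ) :
    embed A (M * M') = embed A M * embed A M' := by
  simp only [embed_eq_submatrix, Matrix.submatrix_mul_equiv, ← Matrix.mul_kronecker_mul, mul_one]

theorem embed_conjTranspose (A : Finset (Fin n)) (M : Matrix (A → Fin 2) (A → Fin 2) ℂ) :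
    embed A M.conjTranspose = (embed A M).conjTranspose := by
  simp only [embed_eq_submatrix, Matrix.conjTranspose_submatrix, Matrix.conjTranspose_kronecker,
    Matrix.conjTranspose_one]

theorem embed_one (A : Finset (Fin n)) : embed A 1 = 1 := by
  rw [embed_eq_submatrix, Matrix.one_kronecker_one, Matrix.submatrix_one_equiv]

theorem trace_embed (A : Finset (Fin n)) (M : Matrix (A → Fin 2) (A → Fin 2) ℂ) :
    (embed A M).trace = M.trace * 2 ^ (n - A.card) := by
  have h := Equiv.sum_comp (Equiv.piEquivPiSubtypeProd (· ∈ A) fun _ => Fin 2) (fun z =>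
    (M ⊗ₖ (1 : Matrix ({i // i ∉ A} → Fin 2) ({i // i ∉ A} → Fin 2) ℂ)) z z)
  rw [embed_eq_submatrix]
  refine h.trans ?_
  change (M ⊗ₖ (1 : Matrix ({i // i ∉ A} → Fin 2) ({i // i ∉ A} → Fin 2) ℂ)).trace = _
  rw [Matrix.trace_kronecker, Matrix.trace_one]
  simp [Fintype.card_subtype_compl]

/-- The operator acts on the qubits in `A` only. -/
structure SupportedOn (A : Finset (Fin n)) (O : Op n) : Prop where
  eq_zero : ∀ x y, ∀ i ∉ A, x i ≠ y i → O x y = 0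
  congr : ∀ x y x' y', (∀ i ∈ A, x i = x' i) → (∀ i ∈ A, y i = y' i) →
    (∀ i ∉ A, x i = y i) → (∀ i ∉ A, x' i = y' i) → O x y = O x' y'

theorem supportedOn_embed (A : Finset (Fin n)) (M : Matrix (A → Fin 2) (A → Fin 2) ℂ) :
    SupportedOn A (embed A M) where
  eq_zero x y i hi h := by
    rw [embed, Matrix.of_apply, if_neg fun h' => h (h' i hi), mul_zero]
  congr x y x' y' h1 h2 h3 h4 := by
    rw [embed, Matrix.of_apply, Matrix.of_apply, if_pos h3, if_pos h4]
    congr 2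
    · exact funext fun i => h1 i i.2
    · exact funext fun i => h2 i i.2

theorem SupportedOn.exists_embed {A : Finset (Fin n)} {O : Op n} (h : SupportedOn A O) :
    ∃ M, O = embed A M := by
  refine ⟨Matrix.of fun a b => O (fun i => if hi : i ∈ A then a ⟨i, hi⟩ else 0)
    (fun i => if hi : i ∈ A then b ⟨i, hi⟩ else 0), ?_⟩
  ext x y
  rw [embed, Matrix.of_apply, Matrix.of_apply]
  split_ifs with hxy
  · rw [mul_one]
    refine h.congr _ _ _ _ ?_ ?_ hxy ?_
    · intro i hi; simp [hi]
    · intro i hi; simp [hi]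
    · intro i hi; simp [hi]
  · push Not at hxy
    obtain ⟨i, hi, hne⟩ := hxy
    rw [mul_zero, h.eq_zero x y i hi hne]

theorem SupportedOn.mul {A : Finset (Fin n)} {O P : Op n} (hO : SupportedOn A O)
    (hP : SupportedOn A P) : SupportedOn A (O * P) := by
  obtain ⟨M, rfl⟩ := hO.exists_embed
  obtain ⟨M', rfl⟩ := hP.exists_embed
  rw [← embed_mul]
  exact supportedOn_embed A _

theorem SupportedOn.conjTranspose {A : Finset (Fin n)} {O : Op n} (hO : SupportedOn A O) :
    SupportedOn A O.conjTranspose := by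
  obtain ⟨M, rfl⟩ := hO.exists_embed
  rw [← embed_conjTranspose]
  exact supportedOn_embed A _

theorem SupportedOn.mono {A B : Finset (Fin n)} (hAB : A ⊆ B) {O : Op n} (h : SupportedOn A O) :
    SupportedOn B O where
  eq_zero x y i hi hne := h.eq_zero x y i (fun hA => hi (hAB hA)) hne
  congr x y x' y' h1 h2 h3 h4 := by
    by_cases hxy : ∀ i ∉ A, x i = y i
    · refine h.congr _ _ _ _ (fun i hi => h1 i (hAB hi)) (fun i hi => h2 i (hAB hi)) hxy ?_
      intro i hi
      by_cases hB : i ∈ B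
      · rw [← h1 i hB, ← h2 i hB, hxy i hi]
      · exact h4 i hB
    · push Not at hxy
      obtain ⟨i, hi, hne⟩ := hxy
      have hB : i ∈ B := by
        by_contra hB
        exact hne (h3 i hB)
      rw [h.eq_zero x y i hi hne, h.eq_zero x' y' i hi]
      rwa [← h1 i hB, ← h2 i hB]

/-- Only one intermediate string survives in the matrix product: `P` cannot change bits in `A`, and
`O` cannot change bits outside `A`. -/
theorem SupportedOn.mul_apply {A B : Finset (Fin n)} (hAB : Disjoint A B) {O P : Op n}
    (hO : SupportedOn A O) (hP : SupportedOn B P) (x y : Bits n) :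
    (O * P) x y = O x (A.piecewise y x) * P (A.piecewise y x) y := by
  rw [Matrix.mul_apply]
  refine Finset.sum_eq_single _ (fun z _ hz => ?_) (fun h => absurd (Finset.mem_univ _) h)
  obtain ⟨i, hi⟩ := Function.ne_iff.1 hz
  by_cases hA : i ∈ A
  · rw [Finset.piecewise_eq_of_mem _ _ _ hA] at hi
    rw [hP.eq_zero z y i (Finset.disjoint_left.1 hAB hA) hi, mul_zero]
  · rw [Finset.piecewise_eq_of_notMem _ _ _ hA] at hi
    rw [hO.eq_zero x z i hA (Ne.symm hi), zero_mul]

theorem SupportedOn.commute {A B : Finset (Fin n)} (hAB : Disjoint A B) {O P : Op n}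
    (hO : SupportedOn A O) (hP : SupportedOn B P) : O * P = P * O := by
  ext x y
  rw [hO.mul_apply hAB hP, hP.mul_apply hAB.symm hO]
  by_cases hxy : ∀ i, i ∉ A → i ∉ B → x i = y i
  · rw [mul_comm]
    congr 1
    · refine hP.congr _ _ _ _ ?_ ?_ ?_ ?_
      · intro i hi
        simp [Finset.piecewise, Finset.disjoint_right.1 hAB hi]
      · intro i hi
        simp [Finset.piecewise, hi]
      · intro i hi
        by_cases hA : i ∈ A
        · simp [Finset.piecewise, hA]
        · simp [Finset.piecewise, hA, hxy i hA hi]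
      · intro i hi
        simp [Finset.piecewise, hi]
    · refine hO.congr _ _ _ _ ?_ ?_ ?_ ?_
      · intro i hi
        simp [Finset.piecewise, Finset.disjoint_left.1 hAB hi]
      · intro i hi
        simp [Finset.piecewise, hi]
      · intro i hi
        simp [Finset.piecewise, hi]
      · intro i hi
        by_cases hB : i ∈ B
        · simp [Finset.piecewise, hB]
        · simp [Finset.piecewise, hB, hxy i hi hB]
  · push Not at hxy
    obtain ⟨i, hA, hB, hne⟩ := hxy
    rw [hP.eq_zero _ y i hB (by simpa [Finset.piecewise, hA] using hne),
      hO.eq_zero _ y i hA (by simpa [Finset.piecewise, hB] using hne), mul_zero, mul_zero]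

/-! ### Layers of gates -/

variable (V : (s : Finset (Fin n)) → Matrix.unitaryGroup (s → Fin 2) ℂ)

theorem layerMatrix_empty : layerMatrix ∅ V = 1 := by
  ext x y
  simp [layerMatrix, Matrix.one_apply, funext_iff]

theorem layerMatrix_singleton (s : Finset (Fin n)) : layerMatrix {s} V = embed s (V s) := by
  ext x y
  simp [layerMatrix, embed]

theorem supportedOn_layerMatrix (L : Finset (Finset (Fin n))) :
    SupportedOn (L.biUnion id) (layerMatrix L V) where
  eq_zero x y i hi hne := by
    rw [layerMatrix, Matrix.of_apply, if_neg, mul_zero]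
    exact fun h => hne (h i fun s hs his => hi (Finset.mem_biUnion.2 ⟨s, hs, his⟩))
  congr x y x' y' h1 h2 h3 h4 := by
    have hL : ∀ i, (∀ s ∈ L, i ∉ s) → i ∉ L.biUnion id := by simp
    rw [layerMatrix, Matrix.of_apply, Matrix.of_apply, if_pos fun i hi => h3 i (hL i hi),
      if_pos fun i hi => h4 i (hL i hi)]
    congr 1
    exact Finset.prod_congr rfl fun s hs => congrArg₂ (V s : Matrix (s → Fin 2) (s → Fin 2) ℂ)
      (funext fun i : s => h1 i (Finset.mem_biUnion.2 ⟨s, hs, i.2⟩))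
      (funext fun i : s => h2 i (Finset.mem_biUnion.2 ⟨s, hs, i.2⟩))

/-- Hypothesis `hL` does not follow from `h`, since the empty set is disjoint from itself. -/
theorem layerMatrix_union {L₁ L₂ : Finset (Finset (Fin n))} (hL : Disjoint L₁ L₂)
    (h : ∀ s ∈ L₁, ∀ t ∈ L₂, Disjoint s t) :
    layerMatrix (L₁ ∪ L₂) V = layerMatrix L₁ V * layerMatrix L₂ V := by
  have hAB : Disjoint (L₁.biUnion id) (L₂.biUnion id) := by
    simpa [Finset.disjoint_biUnion_left, Finset.disjoint_biUnion_right] using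
      fun t ht s hs => h s hs t ht
  ext x y
  rw [(supportedOn_layerMatrix V L₁).mul_apply hAB (supportedOn_layerMatrix V L₂)]
  set z := (L₁.biUnion id).piecewise y x with hz
  have hz1 : ∀ s ∈ L₁, ∀ i ∈ s, z i = y i := fun s hs i hi =>
    Finset.piecewise_eq_of_mem _ _ _ (Finset.mem_biUnion.2 ⟨s, hs, hi⟩)
  have hz0 : ∀ i, (∀ s ∈ L₁, i ∉ s) → z i = x i := fun i hi =>
    Finset.piecewise_eq_of_notMem _ _ _ (by simpa using hi)
  have hz2 : ∀ s ∈ L₂, ∀ i ∈ s, z i = x i := fun s hs i hi =>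
    hz0 i fun t ht hit => Finset.disjoint_left.1 (h t ht s hs) hit hi
  simp only [layerMatrix, Matrix.of_apply]
  rw [if_pos (fun i hi => (hz0 i hi).symm), mul_one, Finset.prod_union hL, mul_assoc]
  congr 1
  · exact Finset.prod_congr rfl fun s hs =>
      congrArg ((V s : Matrix (s → Fin 2) (s → Fin 2) ℂ) _)
        (funext fun i : s => (hz1 s hs i i.2).symm)
  · congr 1
    · exact Finset.prod_congr rfl fun s hs =>
        congrArg₂ (V s : Matrix (s → Fin 2) (s → Fin 2) ℂ)
          (funext fun i : s => (hz2 s hs i i.2).symm) rfl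
    · congr 1
      refine propext ⟨fun H i hi => ?_, fun H i hi => ?_⟩
      · by_cases h1 : ∀ s ∈ L₁, i ∉ s
        · rw [hz0 i h1]
          exact H i fun s hs => (Finset.mem_union.1 hs).elim (h1 s) (hi s)
        · push Not at h1
          obtain ⟨s, hs, his⟩ := h1
          exact hz1 s hs i his
      · rw [← hz0 i fun s hs => hi s (Finset.mem_union_left _ hs)]
        exact H i fun s hs => hi s (Finset.mem_union_right _ hs)

theorem layerMatrix_mem_unitaryGroup (L : Finset (Finset (Fin n)))
    (hL : (L : Set (Finset (Fin n))).PairwiseDisjoint id) :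
    layerMatrix L V ∈ Matrix.unitaryGroup (Bits n) ℂ := by
  induction L using Finset.induction_on with
  | empty => rw [layerMatrix_empty]; exact one_mem _
  | insert s L hs ih =>
    rw [Finset.insert_eq, layerMatrix_union V (Finset.disjoint_singleton_left.2 hs)]
    · refine mul_mem ?_ (ih (hL.subset (by simp)))
      rw [layerMatrix_singleton, Matrix.mem_unitaryGroup_iff, Matrix.star_eq_conjTranspose,
        ← embed_conjTranspose, ← embed_mul, ← Matrix.star_eq_conjTranspose,
        Matrix.mem_unitaryGroup_iff.1 (V s).2, embed_one]
    · intro s' hs' t ht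
      rw [Finset.mem_singleton] at hs'
      subst hs'
      exact hL (by simp) (by simp [ht]) fun e => hs (e ▸ ht)

/-- The set `A` together with all qubits coupled to `A` by a gate in `L`. -/
def grow (L : Finset (Finset (Fin n))) (A : Finset (Fin n)) : Finset (Fin n) :=
  A ∪ (L.filter fun s => ¬ Disjoint s A).biUnion id

/-- Split the layer into the gates meeting `A` and the others. The others commute with `O` and
cancel against their adjoints, so only gates inside `grow L A` remain. -/
theorem SupportedOn.conj_layerMatrix {L : Finset (Finset (Fin n))}
    (hL : (L : Set (Finset (Fin n))).PairwiseDisjoint id) {A : Finset (Fin n)} {O : Op n}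
    (hO : SupportedOn A O) :
    SupportedOn (grow L A) (layerMatrix L V * O * (layerMatrix L V).conjTranspose) := by
  set L₁ := L.filter fun s => ¬ Disjoint s A with hL₁
  set L₂ := L.filter fun s => Disjoint s A with hL₂
  have hd : Disjoint L₁ L₂ := (Finset.disjoint_filter_filter_not L L _).symm
  have hu : L₁ ∪ L₂ = L := by
    rw [Finset.union_comm]
    exact Finset.filter_union_filter_not_eq _ _
  have hdd : ∀ s ∈ L₁, ∀ t ∈ L₂, Disjoint s t := fun s hs t ht =>
    hL (Finset.mem_of_mem_filter s hs) (Finset.mem_of_mem_filter t ht) fun e =>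
      Finset.disjoint_left.1 hd hs (e ▸ ht)
  have hW : layerMatrix L V = layerMatrix L₁ V * layerMatrix L₂ V := by
    rw [← layerMatrix_union V hd hdd, hu]
  have hW2 : layerMatrix L₂ V * (layerMatrix L₂ V).conjTranspose = 1 :=
    Matrix.mem_unitaryGroup_iff.1 (layerMatrix_mem_unitaryGroup V L₂
      (hL.subset (Finset.coe_subset.2 (Finset.filter_subset _ _))))
  have hcomm : layerMatrix L₂ V * O = O * layerMatrix L₂ V :=
    (supportedOn_layerMatrix V L₂).commute
      (by simp [Finset.disjoint_biUnion_left, hL₂]) hO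
  have he : layerMatrix L V * O * (layerMatrix L V).conjTranspose =
      layerMatrix L₁ V * O * (layerMatrix L₁ V).conjTranspose := by
    calc _ = layerMatrix L₁ V * (layerMatrix L₂ V * O) * ((layerMatrix L₂ V).conjTranspose *
          (layerMatrix L₁ V).conjTranspose) := by
          rw [hW, Matrix.conjTranspose_mul]
          simp only [mul_assoc]
      _ = layerMatrix L₁ V * O * (layerMatrix L₂ V * (layerMatrix L₂ V).conjTranspose) *
          (layerMatrix L₁ V).conjTranspose := by
          rw [hcomm]
          simp only [mul_assoc]
      _ = _ := by rw [hW2, mul_one]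
  have h1 : SupportedOn (grow L A) (layerMatrix L₁ V) :=
    (supportedOn_layerMatrix V L₁).mono Finset.subset_union_right
  rw [he]
  exact (h1.mul (hO.mono Finset.subset_union_left)).mul h1.conjTranspose

end Support

/-! ### Circuits -/

section Circuit

variable {n D : ℕ}

/-- The product `U_D ⋯ U_1` of the layers of a circuit. -/
def circuitMatrix (S : CircuitStructure n D) (V : Gates n D) : Op n :=
  Fin.foldl D (fun U t => layerMatrix (S.layer t) (V t) * U) 1

/-- The qubits coupled to the qubit `i` by the layers of gates `ℓ`. -/
def lightCone (ℓ : Fin D → Finset (Finset (Fin n))) (i : Fin n) : Finset (Fin n) :=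
  Fin.foldl D (fun A t => grow (ℓ t) A) {i}

theorem foldl_mulVec (W : Fin D → Op n) (v : Bits n → ℂ) :
    Fin.foldl D (fun v t => (W t).mulVec v) v =
      (Fin.foldl D (fun U t => W t * U) 1).mulVec v := by
  induction D with
  | zero => simp
  | succ D ih => rw [Fin.foldl_succ_last, Fin.foldl_succ_last, ih, Matrix.mulVec_mulVec]

theorem outputVector_eq (S : CircuitStructure n D) (V : Gates n D) :
    outputVector S V = (circuitMatrix S V).mulVec (Pi.single (fun _ => 0) 1) :=
  foldl_mulVec _ _

theorem foldl_mul_mem_unitaryGroup {W : Fin D → Op n}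
    (hW : ∀ t, W t ∈ Matrix.unitaryGroup (Bits n) ℂ) :
    Fin.foldl D (fun U t => W t * U) 1 ∈ Matrix.unitaryGroup (Bits n) ℂ := by
  induction D with
  | zero => simp
  | succ D ih =>
    rw [Fin.foldl_succ_last]
    exact mul_mem (hW _) (ih fun t => hW _)

theorem circuitMatrix_mem_unitaryGroup (S : CircuitStructure n D) (V : Gates n D) :
    circuitMatrix S V ∈ Matrix.unitaryGroup (Bits n) ℂ :=
  foldl_mul_mem_unitaryGroup fun t => layerMatrix_mem_unitaryGroup _ _ (S.disjoint_gates t)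

/-- The first layers sit innermost in the conjugation, so the support grows in circuit order, with
the last layer acting last. Arbitrary `W` and `g` let the induction drop that layer. -/
theorem SupportedOn.conj_foldl {W : Fin D → Op n} {g : Fin D → Finset (Fin n) → Finset (Fin n)}
    (hW : ∀ t A O, SupportedOn A O → SupportedOn (g t A) (W t * O * (W t).conjTranspose))
    {A : Finset (Fin n)} {O : Op n} (hO : SupportedOn A O) :
    SupportedOn (Fin.foldl D (fun A t => g t A) A)
      (Fin.foldl D (fun U t => W t * U) 1 * O *
        (Fin.foldl D (fun U t => W t * U) 1).conjTranspose) := by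
  induction D with
  | zero => simpa using hO
  | succ D ih =>
    rw [Fin.foldl_succ_last, Fin.foldl_succ_last]
    have h := hW (Fin.last D) _ _ (ih fun t => hW t.castSucc)
    simpa only [Matrix.conjTranspose_mul, mul_assoc] using h

theorem SupportedOn.conj_circuitMatrix (S : CircuitStructure n D) (V : Gates n D) {i : Fin n}
    {O : Op n} (hO : SupportedOn {i} O) :
    SupportedOn (lightCone S.layer i)
      (circuitMatrix S V * O * (circuitMatrix S V).conjTranspose) :=
  SupportedOn.conj_foldl (fun t _ _ h => h.conj_layerMatrix _ (S.disjoint_gates t)) hO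

end Circuit

/-! ### Sizes of light cones -/

section LightCone

variable {n D : ℕ}

/-- In a layer of gates on at most two qubits, every qubit is coupled to at most one other. -/
theorem exists_grow_eq_union_image {L : Finset (Finset (Fin n))}
    (hcard : ∀ s ∈ L, s.card = 1 ∨ s.card = 2)
    (hL : (L : Set (Finset (Fin n))).PairwiseDisjoint id) :
    ∃ f : Fin n → Fin n, (∀ a, f a = a ∨ f a ≠ a ∧ ∃ s ∈ L, a ∈ s ∧ f a ∈ s) ∧
      ∀ A, grow L A = A ∪ A.image f := by
  classical
  have key : ∀ a, ∃ b, (b = a ∨ b ≠ a ∧ ∃ s ∈ L, a ∈ s ∧ b ∈ s) ∧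
      ∀ s ∈ L, a ∈ s → ∀ x ∈ s, x = a ∨ x = b := by
    intro a
    by_cases h : ∃ b, b ≠ a ∧ ∃ s ∈ L, a ∈ s ∧ b ∈ s
    · obtain ⟨b, hba, s, hs, has, hbs⟩ := h
      refine ⟨b, Or.inr ⟨hba, s, hs, has, hbs⟩, fun s' hs' has' x hx => ?_⟩
      have hss : s' = s := by
        by_contra hne
        exact Finset.disjoint_left.1 (hL hs' hs hne) has' has
      subst hss
      by_contra! hx'
      have h3 : ({a, b, x} : Finset (Fin n)).card ≤ s'.card := Finset.card_le_card (by
        intro y hy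
        simp only [Finset.mem_insert, Finset.mem_singleton] at hy
        rcases hy with rfl | rfl | rfl <;> assumption)
      rw [Finset.card_eq_three.2 ⟨a, b, x, hba.symm, hx'.1.symm, hx'.2.symm, rfl⟩] at h3
      rcases hcard s' hs' with h | h <;> omega
    · push Not at h
      refine ⟨a, Or.inl rfl, fun s hs has x hx => Or.inl ?_⟩
      by_contra hxa
      exact h x hxa s hs has hx
  choose f hf hf' using key
  refine ⟨f, hf, fun A => Finset.Subset.antisymm ?_ ?_⟩
  · refine Finset.union_subset Finset.subset_union_left fun x hx => ?_
    obtain ⟨s, hs, hxs⟩ := Finset.mem_biUnion.1 hx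
    obtain ⟨hsL, hsA⟩ := Finset.mem_filter.1 hs
    obtain ⟨a, has, haA⟩ := Finset.not_disjoint_iff.1 hsA
    rcases hf' a s hsL has x hxs with rfl | rfl
    · exact Finset.mem_union_left _ haA
    · exact Finset.mem_union_right _ (Finset.mem_image_of_mem f haA)
  · refine Finset.union_subset Finset.subset_union_left fun x hx => ?_
    obtain ⟨a, haA, rfl⟩ := Finset.mem_image.1 hx
    rcases hf a with h | ⟨-, s, hs, has, hfs⟩
    · rw [h]
      exact Finset.mem_union_left _ haA
    · exact Finset.mem_union_right _ (Finset.mem_biUnion.2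
        ⟨s, Finset.mem_filter.2 ⟨hs, Finset.not_disjoint_iff.2 ⟨a, has, haA⟩⟩, hfs⟩)

theorem lightCone_succ (ℓ : Fin (D + 1) → Finset (Finset (Fin n))) (i : Fin n) :
    lightCone ℓ i = grow (ℓ (Fin.last D)) (lightCone (fun t => ℓ t.castSucc) i) := by
  rw [lightCone, Fin.foldl_succ_last, lightCone]

theorem lightCone_zero (ℓ : Fin 0 → Finset (Finset (Fin n))) (i : Fin n) :
    lightCone ℓ i = {i} := by
  rw [lightCone, Fin.foldl_zero]

theorem card_lightCone_le_two_pow {ℓ : Fin D → Finset (Finset (Fin n))}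
    (hcard : ∀ t, ∀ s ∈ ℓ t, s.card = 1 ∨ s.card = 2)
    (hℓ : ∀ t, (ℓ t : Set (Finset (Fin n))).PairwiseDisjoint id) (i : Fin n) :
    (lightCone ℓ i).card ≤ 2 ^ D := by
  induction D with
  | zero => simp [lightCone_zero]
  | succ D ih =>
    obtain ⟨f, -, hg⟩ := exists_grow_eq_union_image (hcard (Fin.last D)) (hℓ (Fin.last D))
    rw [lightCone_succ, hg]
    have h1 := ih (fun t => hcard t.castSucc) fun t => hℓ t.castSucc
    refine (Finset.card_union_le _ _).trans ?_
    have h2 := Finset.card_image_le (s := lightCone (fun t => ℓ t.castSucc) i) (f := f)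
    rw [pow_succ]
    omega

theorem image_lightCone_mem_latticeGrowth {ℓ : Fin D → Finset (Finset (Fin n))}
    (hcard : ∀ t, ∀ s ∈ ℓ t, s.card = 1 ∨ s.card = 2)
    (hℓ : ∀ t, (ℓ t : Set (Finset (Fin n))).PairwiseDisjoint id)
    {pos : Fin n → ℤ × ℤ} (hpos : Function.Injective pos)
    (hadj : ∀ t, ∀ s ∈ ℓ t, ∀ i ∈ s, ∀ j ∈ s, i ≠ j → LatticeAdj (pos i) (pos j)) {i : Fin n}
    (hi : pos i = (0, 0)) : (lightCone ℓ i).image pos ∈ latticeGrowth D := by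
  induction D with
  | zero => simp [lightCone_zero, latticeGrowth, hi]
  | succ D ih =>
    obtain ⟨f, hf, hg⟩ := exists_grow_eq_union_image (hcard (Fin.last D)) (hℓ (Fin.last D))
    refine ⟨_, ih (fun t => hcard t.castSucc) (fun t => hℓ t.castSucc)
      -- Transport the partner map to the lattice through the injection `pos`; at sites carrying no
      -- qubit it is the identity.
      (fun t => hadj t.castSucc), Function.extend pos (pos ∘ f) id, ?_, ?_⟩
    · intro p hp
      obtain ⟨a, -, rfl⟩ := Finset.mem_image.1 hp
      rw [hpos.extend_apply]
      rcases hf a with h | ⟨hne, s, hs, has, hfs⟩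
      · exact Or.inl (congrArg pos h)
      · exact Or.inr (hadj _ s hs a has _ hfs hne.symm)
    · rw [lightCone_succ, hg, Finset.image_union, Finset.image_image, Finset.image_image]
      congr 2
      funext a
      exact (hpos.extend_apply _ _ a).symm

/-- The cone lies in a window of the chain. The first layer yields two sites only, as a qubit has at
most one partner, and each later layer adds one site at either end. With `D + 1` layers the window
has `2 * (D + 1)` sites; starting from the one-site window would lose one. -/
theorem exists_lightCone_bounds {ℓ : Fin (D + 1) → Finset (Finset (Fin n))}
    (hcard : ∀ t, ∀ s ∈ ℓ t, s.card = 1 ∨ s.card = 2)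
    (hℓ : ∀ t, (ℓ t : Set (Finset (Fin n))).PairwiseDisjoint id) {pos : Fin n → ℤ}
    (hadj : ∀ t, ∀ s ∈ ℓ t, ∀ i ∈ s, ∀ j ∈ s, i ≠ j → |pos i - pos j| = 1) (i : Fin n) :
    ∃ c : ℤ, ∀ j ∈ lightCone ℓ i, c ≤ pos j ∧ pos j ≤ c + (2 * D + 1) := by
  induction D with
  | zero =>
    obtain ⟨f, hf, hg⟩ := exists_grow_eq_union_image (hcard (Fin.last 0)) (hℓ (Fin.last 0))
    rw [lightCone_succ, hg, lightCone_zero]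
    refine ⟨min (pos i) (pos (f i)), fun j hj => ?_⟩
    have hfi : |pos i - pos (f i)| ≤ 1 := by
      rcases hf i with h | ⟨hne, s, hs, has, hfs⟩
      · simp [h]
      · exact (hadj _ s hs i has _ hfs hne.symm).le
    rw [abs_le] at hfi
    simp only [Finset.image_singleton, Finset.mem_union, Finset.mem_singleton] at hj
    push_cast
    rcases hj with rfl | rfl <;> omega
  | succ D ih =>
    obtain ⟨f, hf, hg⟩ :=
      exists_grow_eq_union_image (hcard (Fin.last (D + 1))) (hℓ (Fin.last (D + 1)))
    obtain ⟨c, hc⟩ := ih (fun t => hcard t.castSucc) (fun t => hℓ t.castSucc)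
      (fun t => hadj t.castSucc)
    rw [lightCone_succ, hg]
    refine ⟨c - 1, fun j hj => ?_⟩
    push_cast
    rcases Finset.mem_union.1 hj with hj | hj
    · have := hc j hj
      omega
    · obtain ⟨a, ha, rfl⟩ := Finset.mem_image.1 hj
      have h1 := hc a ha
      have hfa : |pos a - pos (f a)| ≤ 1 := by
        rcases hf a with h | ⟨hne, s, hs, has, hfs⟩
        · simp [h]
        · exact (hadj _ s hs a has _ hfs hne.symm).le
      rw [abs_le] at hfa
      omega

/-- Depth zero is excluded because of the chain, where `k` would be `0` while the cone has one
qubit. -/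
theorem card_lightCone_le {g : Geometry} (hD : 0 < D) (S : CircuitStructure n D)
    (hS : S.IsLocal g) (i : Fin n) : (lightCone S.layer i).card ≤ g.locality D := by
  cases g with
  | general => exact card_lightCone_le_two_pow S.card_gate S.disjoint_gates i
  | chain =>
    obtain ⟨pos, hpos, hadj⟩ := hS
    obtain ⟨D, rfl⟩ := Nat.exists_eq_succ_of_ne_zero hD.ne'
    obtain ⟨c, hc⟩ := exists_lightCone_bounds S.card_gate S.disjoint_gates hadj i
    have h := Finset.card_le_card_of_injOn pos
      (t := Finset.Icc c (c + (2 * D + 1)))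
      (fun j hj => Finset.mem_coe.2 (Finset.mem_Icc.2 (hc j hj)))
      hpos.injOn
    rw [Int.card_Icc] at h
    simp only [Geometry.locality]
    omega
  | square =>
    obtain ⟨pos, hpos, hadj⟩ := hS
    -- Translate the placement so that qubit `i` sits at the origin, where `latticeGrowth` starts.
    have hpos' : Function.Injective fun j => pos j - pos i := fun a b h =>
      hpos (sub_left_injective h)
    have h := image_lightCone_mem_latticeGrowth S.card_gate S.disjoint_gates hpos'
      (fun t s hs a ha b hb hab => by simpa [LatticeAdj] using hadj t s hs a ha b hb hab)
      (i := i) (sub_self _)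
    refine le_csSup ⟨2 ^ D, ?_⟩ ⟨_, h, Finset.card_image_of_injective _ hpos'⟩
    rintro _ ⟨T, hT, rfl⟩
    exact card_le_of_mem_latticeGrowth D T hT

end LightCone

/-! ### Classical shadows of local marginals -/

theorem sum_prod_pi_prod_pi {ι α β : Type*} [Fintype ι] [DecidableEq ι] [Fintype α] [Fintype β]
    {R : Type*} [CommSemiring R] (F : ι → α → β → R) :
    ∑ r : (ι → α) × (ι → β), ∏ i, F i (r.1 i) (r.2 i) = ∏ i, ∑ s : α × β, F i s.1 s.2 := by
  have h := Finset.prod_univ_sum (fun _ : ι => (Finset.univ : Finset (α × β)))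
    (fun i s => F i s.1 s.2)
  rw [h, Fintype.piFinset_univ,
    ← (Equiv.arrowProdEquivProdArrow ι (fun _ => α) (fun _ => β)).sum_comp]
  rfl

/-- The single-qubit shadow `3 P - 1` of a measurement outcome with projector `P`. -/
def qubitShadow (a : Fin 3) (b : Fin 2) : Matrix (Fin 2) (Fin 2) ℂ :=
  (3 : ℂ) • pauliProj a b - 1

theorem pauliProj_mul_conjTranspose (a : Fin 3) (b : Fin 2) :
    pauliProj a b * (pauliProj a b).conjTranspose = pauliProj a b := by
  fin_cases a <;> fin_cases b <;> ext x y <;> fin_cases x <;> fin_cases y <;>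
    simp [pauliProj, pauli, Matrix.mul_apply, Fin.sum_univ_two, Complex.ext_iff] <;> norm_num

theorem sum_pauliProj (x y : Fin 2) :
    ∑ s : Fin 3 × Fin 2, pauliProj s.1 s.2 x y = if x = y then 3 else 0 := by
  fin_cases x <;> fin_cases y <;>
    simp [Fintype.sum_prod_type, Fin.sum_univ_three, Fin.sum_univ_two, pauliProj, pauli] <;>
    ring

/-- Summed over the six outcomes, `P ⊗ (3P - 1)` is three times the swap operator. This identity
makes the shadow an unbiased inverse of the measurement. -/
theorem sum_pauliProj_mul_qubitShadow (x y a b : Fin 2) :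
    ∑ s : Fin 3 × Fin 2, pauliProj s.1 s.2 x y * qubitShadow s.1 s.2 a b =
      if x = b ∧ y = a then 3 else 0 := by
  fin_cases x <;> fin_cases y <;> fin_cases a <;> fin_cases b <;>
    simp [Fintype.sum_prod_type, Fin.sum_univ_three, Fin.sum_univ_two, qubitShadow, pauliProj,
      pauli] <;> ring_nf <;> simp [Complex.I_sq] <;> norm_num

/-- The matrix `3P - 1` has eigenvalues `2` and `-1`, and `4 + 1 = 5`. This is the origin of the
factor `5^k` in the sample size. -/
theorem sum_norm_sq_qubitShadow (a : Fin 3) (b : Fin 2) :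
    ∑ s : Fin 2 × Fin 2, ‖qubitShadow a b s.1 s.2‖ ^ 2 = 5 := by
  fin_cases a <;> fin_cases b <;>
    simp [Fintype.sum_prod_type, Fin.sum_univ_two, qubitShadow, pauliProj, pauli,
      ← Complex.normSq_eq_norm_sq, Complex.normSq_apply] <;> norm_num

section Shadow

variable {n : ℕ}

/-- Vectors of matrix entries of operators on the qubits in `A`. -/
abbrev LocalOp (A : Finset (Fin n)) : Type := EuclideanSpace ℂ ((A → Fin 2) × (A → Fin 2))

/-- The classical shadow of a record on the qubits in `A`. -/
def shadow (A : Finset (Fin n)) (r : Record n) : LocalOp A :=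
  WithLp.toLp 2 fun ab => ∏ i : A, qubitShadow (r.1 i) (r.2 i) (ab.1 i) (ab.2 i)

/-- The expected shadow, which is the reduced state of `ρ` on `A`. -/
def marginal (A : Finset (Fin n)) (ρ : Op n) : LocalOp A :=
  ∑ r, (recordProb ρ r : ℂ) • shadow A r

theorem norm_shadow_sq (A : Finset (Fin n)) (r : Record n) : ‖shadow A r‖ ^ 2 = 5 ^ A.card := by
  rw [EuclideanSpace.norm_sq_eq]
  simp only [shadow, norm_prod, ← Finset.prod_pow]
  rw [sum_prod_pi_prod_pi fun (i : A) a b => ‖qubitShadow (r.1 i) (r.2 i) a b‖ ^ 2]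
  simp [sum_norm_sq_qubitShadow]

theorem recordProj_mul_conjTranspose (r : Record n) :
    recordProj r * (recordProj r).conjTranspose = recordProj r := by
  ext x y
  have h := Finset.prod_univ_sum (fun _ : Fin n => (Finset.univ : Finset (Fin 2)))
    (fun i z => pauliProj (r.1 i) (r.2 i) (x i) z * (pauliProj (r.1 i) (r.2 i)).conjTranspose z (y i))
  simp only [← Matrix.mul_apply, pauliProj_mul_conjTranspose, Fintype.piFinset_univ] at h
  rw [recordProj, Matrix.of_apply, h, Matrix.mul_apply]
  refine Finset.sum_congr rfl fun z _ => ?_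
  simp [Matrix.conjTranspose_apply, Finset.prod_mul_distrib]

theorem trace_mul_recordProj_nonneg {ρ : Op n} (hρ : ρ.PosSemidef) (r : Record n) :
    0 ≤ (ρ * recordProj r).trace := by
  rw [← recordProj_mul_conjTranspose, ← mul_assoc, Matrix.trace_mul_comm, ← mul_assoc]
  exact (hρ.conjTranspose_mul_mul_same (recordProj r)).trace_nonneg

theorem ofReal_recordProb {ρ : Op n} (hρ : ρ.PosSemidef) (r : Record n) :
    (recordProb ρ r : ℂ) = (1 / 3) ^ n * (ρ * recordProj r).trace := by
  have h := Complex.eq_re_of_ofReal_le (r := 0) (by simpa using trace_mul_recordProj_nonneg hρ r)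
  rw [recordProb, h]
  simp

theorem recordProb_nonneg {ρ : Op n} (hρ : ρ.PosSemidef) (r : Record n) : 0 ≤ recordProb ρ r :=
  mul_nonneg (by positivity) (Complex.le_def.1 (trace_mul_recordProj_nonneg hρ r)).1

/-- Random Pauli measurements are informationally complete: reconstruction of local operators. -/
theorem embed_eq_sum_shadow (A : Finset (Fin n)) (M : Matrix (A → Fin 2) (A → Fin 2) ℂ) :
    embed A M = ∑ r : Record n, ((1 / 3) ^ n * ∑ ab, shadow A r ab * M ab.2 ab.1) •
      recordProj r := by
  ext x y
  have hfac : ∀ (ab : (A → Fin 2) × (A → Fin 2)),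
      ∑ r : Record n, (1 / 3 : ℂ) ^ n * shadow A r ab * recordProj r x y =
        if ab = ((fun i : A => y i), (fun i : A => x i)) ∧ ∀ i, i ∉ A → x i = y i then 1 else 0 := by
    rintro ⟨a, b⟩
    have h1 : ∀ r : Record n, (1 / 3 : ℂ) ^ n * shadow A r (a, b) * recordProj r x y =
        ∏ i, (1 / 3 * (if h : i ∈ A then qubitShadow (r.1 i) (r.2 i) (a ⟨i, h⟩) (b ⟨i, h⟩) else 1) *
          pauliProj (r.1 i) (r.2 i) (x i) (y i)) := by
      intro r
      rw [Finset.prod_mul_distrib, Finset.prod_mul_distrib, Finset.prod_const, Finset.card_univ,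
        Fintype.card_fin, recordProj, Matrix.of_apply]
      congr 2
      rw [← Finset.prod_subset (Finset.subset_univ A) fun i _ hi => dif_neg hi,
        ← Finset.prod_coe_sort]
      simp [shadow]
    simp only [h1]
    rw [sum_prod_pi_prod_pi fun i c d => 1 / 3 *
      (if h : i ∈ A then qubitShadow c d (a ⟨i, h⟩) (b ⟨i, h⟩) else 1) * pauliProj c d (x i) (y i)]
    -- A qubit in `A` contributes a swap, a qubit outside `A` the resolution of the identity; the
    -- basis probability `1 / 3` normalises both.
    have h2 : ∀ i, ∑ s : Fin 3 × Fin 2, 1 / 3 *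
        (if h : i ∈ A then qubitShadow s.1 s.2 (a ⟨i, h⟩) (b ⟨i, h⟩) else 1) *
          pauliProj s.1 s.2 (x i) (y i) =
        if (∀ h : i ∈ A, x i = b ⟨i, h⟩ ∧ y i = a ⟨i, h⟩) ∧ (i ∉ A → x i = y i) then 1 else 0 := by
      intro i
      by_cases h : i ∈ A
      · simp only [h, dif_pos, not_true_eq_false, false_imp_iff, and_true, forall_true_left,
          mul_assoc, ← Finset.mul_sum]
        simp only [mul_comm (qubitShadow _ _ _ _), sum_pauliProj_mul_qubitShadow]
        split_ifs <;> norm_num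
      · simp only [h, dif_neg, not_false_eq_true, mul_one, ← Finset.mul_sum, sum_pauliProj]
        by_cases hxy : x i = y i <;> simp [hxy]
    simp only [h2]
    rw [Finset.prod_ite_zero]
    simp only [Finset.prod_const_one]
    congr 1
    simp only [Finset.mem_univ, forall_true_left, Prod.mk.injEq, funext_iff, Subtype.forall,
      eq_iff_iff]
    constructor
    · intro H
      exact ⟨⟨fun i hi => ((H i).1 hi).2.symm, fun i hi => ((H i).1 hi).1.symm⟩, fun i => (H i).2⟩
    · intro H i
      exact ⟨fun hi => ⟨(H.1.2 i hi).symm, (H.1.1 i hi).symm⟩, H.2 i⟩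
  rw [Matrix.sum_apply]
  simp only [Matrix.smul_apply, smul_eq_mul, Finset.mul_sum, Finset.sum_mul]
  rw [Finset.sum_comm]
  have h3 : ∀ ab : (A → Fin 2) × (A → Fin 2),
      ∑ r : Record n, (1 / 3 : ℂ) ^ n * (shadow A r ab * M ab.2 ab.1) * recordProj r x y =
        (if ab = ((fun i : A => y i), (fun i : A => x i)) ∧ ∀ i, i ∉ A → x i = y i then 1 else 0) *
          M ab.2 ab.1 := by
    intro ab
    rw [← hfac, Finset.sum_mul]
    exact Finset.sum_congr rfl fun r _ => by ring
  simp only [h3]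
  rw [Finset.sum_eq_single ((fun i : A => y i), (fun i : A => x i))]
  · simp only [true_and]
    rw [embed, Matrix.of_apply, mul_comm]
  · intro ab _ hab
    rw [if_neg fun h => hab h.1, zero_mul]
  · exact fun h => absurd (Finset.mem_univ _) h

/-- This justifies the name `marginal`: expectations of operators on `A` depend on the state only
through its expected shadow. -/
theorem trace_mul_embed {ρ : Op n} (hρ : ρ.PosSemidef) (A : Finset (Fin n))
    (M : Matrix (A → Fin 2) (A → Fin 2) ℂ) :
    (ρ * embed A M).trace = ∑ ab, marginal A ρ ab * M ab.2 ab.1 := by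
  have h1 : ∀ ab, marginal A ρ ab = ∑ r, (recordProb ρ r : ℂ) * shadow A r ab := by
    intro ab
    simp [marginal]
  simp only [h1, Finset.sum_mul]
  rw [Finset.sum_comm, embed_eq_sum_shadow, Matrix.mul_sum, Matrix.trace_sum]
  refine Finset.sum_congr rfl fun r _ => ?_
  rw [Matrix.mul_smul, Matrix.trace_smul, ofReal_recordProb hρ, smul_eq_mul, Finset.mul_sum,
    Finset.sum_mul]
  exact Finset.sum_congr rfl fun ab _ => by ring

theorem sum_recordProb {ρ : Op n} (hρ : IsState ρ) : ∑ r, recordProb ρ r = 1 := by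
  -- On the empty set of qubits every shadow is the number `1`, so the expected shadow is the total
  -- probability.
  have h := trace_mul_embed hρ.1 ∅ 1
  rw [embed_one, mul_one, hρ.2] at h
  have h2 : ∑ ab, marginal ∅ ρ ab * (1 : Matrix ((∅ : Finset (Fin n)) → Fin 2) _ ℂ) ab.2 ab.1 =
      ((∑ r, recordProb ρ r : ℝ) : ℂ) := by
    simp [marginal, shadow, Fintype.sum_prod_type, Matrix.one_apply]
  rw [h2] at h
  exact_mod_cast h.symm

theorem norm_sum_mul_le {A : Finset (Fin n)} (z : LocalOp A)
    (M : Matrix (A → Fin 2) (A → Fin 2) ℂ) :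
    ‖∑ ab, z ab * M ab.2 ab.1‖ ≤ ‖z‖ * √((M.conjTranspose * M).trace.re) := by
  set u : LocalOp A := WithLp.toLp 2 fun ab => star (M ab.2 ab.1) with hu
  have h1 : inner ℂ u z = ∑ ab, z ab * M ab.2 ab.1 := by
    simp [hu, PiLp.inner_apply]
  have h2 : ‖u‖ = √((M.conjTranspose * M).trace.re) := by
    rw [EuclideanSpace.norm_eq]
    congr 1
    simp [hu, Fintype.sum_prod_type, Matrix.trace, Matrix.mul_apply,
      ← Complex.normSq_eq_conj_mul_self, Complex.normSq_eq_norm_sq]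
    simp only [← Complex.ofReal_pow, Complex.ofReal_re]
  rw [← h1, ← h2, mul_comm]
  exact norm_inner_le_norm u z

end Shadow

/-! ### The parent Hamiltonian of an output state -/

section Parent

variable {n D : ℕ}

/-- The projector onto the state `|1⟩` of the qubit `i`. -/
def excitation (i : Fin n) : Op n := Matrix.diagonal fun x => if x i = 1 then 1 else 0

theorem supportedOn_excitation (i : Fin n) : SupportedOn {i} (excitation i) where
  eq_zero x y j _ hne := Matrix.diagonal_apply_ne _ fun h => hne (congrFun h j)
  congr x y x' y' h1 h2 h3 h4 := by
    simp only [Finset.mem_singleton, forall_eq] at h1 h2 h3 h4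
    by_cases hxy : x i = y i
    · have e : x = y := funext fun j => by
        by_cases hj : j = i
        · rw [hj, hxy]
        · exact h3 j hj
      have e' : x' = y' := funext fun j => by
        by_cases hj : j = i
        · rw [hj, ← h1, ← h2, hxy]
        · exact h4 j hj
      rw [← e, ← e', excitation, Matrix.diagonal_apply_eq, Matrix.diagonal_apply_eq, h1]
    · rw [excitation, Matrix.diagonal_apply_ne _ fun h => hxy (congrFun h i),
        Matrix.diagonal_apply_ne _ fun h => hxy (by rw [h1, h2]; exact congrFun h i)]

theorem excitation_conjTranspose_mul_self (i : Fin n) :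
    (excitation i).conjTranspose * excitation i = excitation i := by
  simp [excitation, Matrix.diagonal_conjTranspose, Pi.star_def]

theorem trace_mul_excitation (ρ : Op n) (i : Fin n) :
    (ρ * excitation i).trace = ∑ x, if x i = 1 then ρ x x else 0 := by
  simp [excitation, Matrix.trace, Matrix.mul_diagonal]

theorem trace_excitation_re_le (i : Fin n) : (excitation i).trace.re ≤ 2 ^ n := by
  have h := trace_mul_excitation (1 : Op n) i
  rw [one_mul] at h
  rw [h, Complex.re_sum]
  calc _ ≤ ∑ _x : Bits n, (1 : ℝ) := Finset.sum_le_sum fun x _ => by split_ifs <;> simp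
    _ = 2 ^ n := by simp

/-- A union bound on the diagonal of `ρ`: every nonzero bit string has a bit equal to `1`, so its
weight is counted at least once on the right. -/
theorem one_sub_le_sum_trace_mul_excitation {ρ : Op n} (hρ : IsState ρ) :
    1 - (ρ (fun _ => 0) (fun _ => 0)).re ≤ ∑ i, (ρ * excitation i).trace.re := by
  have hd : ∀ x, 0 ≤ (ρ x x).re := fun x => (Complex.le_def.1 (hρ.1.diag_nonneg)).1
  have h1 : ∑ x, (ρ x x).re = 1 := by
    rw [← Complex.re_sum]
    exact congrArg Complex.re hρ.2
  simp only [trace_mul_excitation, Complex.re_sum]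
  rw [Finset.sum_comm, ← h1, ← Finset.add_sum_erase _ _ (Finset.mem_univ fun _ => 0),
    add_sub_cancel_left]
  refine (Finset.sum_le_sum fun x hx => ?_).trans
    (Finset.sum_le_sum_of_subset_of_nonneg (Finset.erase_subset _ _) fun x _ _ => ?_)
  · obtain ⟨i, hi⟩ := Function.ne_iff.1 (Finset.ne_of_mem_erase hx)
    have hi1 : x i = 1 := by omega
    refine le_trans (by rw [if_pos hi1]) (Finset.single_le_sum (f := fun i =>
      (if x i = 1 then ρ x x else 0).re) (fun j _ => ?_) (Finset.mem_univ i))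
    change 0 ≤ (if x j = 1 then ρ x x else 0 : ℂ).re
    split_ifs
    exacts [hd x, le_rfl]
  · refine Finset.sum_nonneg fun j _ => ?_
    split_ifs
    exacts [hd x, le_rfl]

/-- The terms of the parent Hamiltonian of the output state of a circuit. -/
def parentTerm (S : CircuitStructure n D) (V : Gates n D) (i : Fin n) : Op n :=
  circuitMatrix S V * excitation i * (circuitMatrix S V).conjTranspose

variable (S : CircuitStructure n D) (V : Gates n D)

theorem conjTranspose_circuitMatrix_mul_self :
    (circuitMatrix S V).conjTranspose * circuitMatrix S V = 1 :=
  Matrix.mem_unitaryGroup_iff'.1 (circuitMatrix_mem_unitaryGroup S V)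

theorem circuitMatrix_mul_conjTranspose_self :
    circuitMatrix S V * (circuitMatrix S V).conjTranspose = 1 :=
  Matrix.mem_unitaryGroup_iff.1 (circuitMatrix_mem_unitaryGroup S V)

theorem star_outputVector_dotProduct_mulVec (ρ : Op n) :
    star (outputVector S V) ⬝ᵥ ρ.mulVec (outputVector S V) =
      ((circuitMatrix S V).conjTranspose * ρ * circuitMatrix S V) (fun _ => 0) (fun _ => 0) := by
  rw [outputVector_eq, Matrix.star_mulVec, ← Matrix.dotProduct_mulVec, Matrix.mulVec_mulVec,
    Matrix.mulVec_mulVec]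
  simp

theorem star_outputVector_dotProduct_self : star (outputVector S V) ⬝ᵥ outputVector S V = 1 := by
  have h := star_outputVector_dotProduct_mulVec S V 1
  rwa [Matrix.one_mulVec, mul_one, conjTranspose_circuitMatrix_mul_self, Matrix.one_apply_eq] at h

theorem isState_outputState : IsState (outputState S V) :=
  isState_vecMulVec (star_outputVector_dotProduct_self S V)

theorem trace_mul_parentTerm (ρ : Op n) (i : Fin n) :
    (ρ * parentTerm S V i).trace =
      ((circuitMatrix S V).conjTranspose * ρ * circuitMatrix S V * excitation i).trace := by
  rw [parentTerm, ← mul_assoc, Matrix.trace_mul_comm]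
  simp only [mul_assoc]

theorem one_sub_fidelity_le {ρ : Op n} (hρ : IsState ρ) :
    1 - (star (outputVector S V) ⬝ᵥ ρ.mulVec (outputVector S V)).re ≤
      ∑ i, (ρ * parentTerm S V i).trace.re := by
  simp only [star_outputVector_dotProduct_mulVec, trace_mul_parentTerm]
  -- Undo the circuit: the bound for `|0⟩^{⊗ n}` is applied to `Uᴴ ρ U`.
  refine one_sub_le_sum_trace_mul_excitation ⟨hρ.1.conjTranspose_mul_mul_same _, ?_⟩
  rw [Matrix.trace_mul_comm, ← mul_assoc, circuitMatrix_mul_conjTranspose_self, one_mul, hρ.2]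

theorem trace_outputState_mul_parentTerm (i : Fin n) :
    (outputState S V * parentTerm S V i).trace = 0 := by
  have h : (circuitMatrix S V).conjTranspose * outputState S V * circuitMatrix S V =
      Matrix.vecMulVec (Pi.single (fun _ => 0) 1) (Pi.single (fun _ => 0) 1) := by
    have h1 : (circuitMatrix S V).conjTranspose.mulVec (outputVector S V) =
        Pi.single (fun _ => 0) 1 := by
      rw [outputVector_eq, Matrix.mulVec_mulVec, conjTranspose_circuitMatrix_mul_self,
        Matrix.one_mulVec]
    have h2 : Matrix.vecMul (star (outputVector S V)) (circuitMatrix S V) =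
        Pi.single (fun _ => 0) 1 := by
      have h3 := congrArg star h1
      rwa [Matrix.star_mulVec, Matrix.conjTranspose_conjTranspose, ← Pi.single_star,
        star_one] at h3
    rw [outputState, Matrix.mul_vecMulVec, Matrix.vecMulVec_mul, h1, h2]
  rw [trace_mul_parentTerm, h, trace_mul_excitation]
  refine Finset.sum_eq_zero fun x _ => ?_
  split_ifs with hx
  · have hx0 : x ≠ fun _ => 0 := fun h => by simp [h] at hx
    simp [Matrix.vecMulVec_apply, hx0]
  · rfl

theorem exists_parentTerm_eq_embed {A : Finset (Fin n)} {i : Fin n}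
    (hA : lightCone S.layer i ⊆ A) :
    ∃ M, parentTerm S V i = embed A M ∧ (M.conjTranspose * M).trace.re ≤ 2 ^ A.card := by
  obtain ⟨M, hM⟩ :=
    (((supportedOn_excitation i).conj_circuitMatrix S V).mono hA).exists_embed
  refine ⟨M, hM, ?_⟩
  -- The squared Hilbert–Schmidt norm is unitarily invariant, so it can be computed for the
  -- projector `excitation i`. Dividing by the `2 ^ (n - A.card)` contributed by the identity factor
  -- leaves at most `2 ^ A.card`.
  have h1 : (embed A (M.conjTranspose * M)).trace = (excitation i).trace := by
    rw [embed_mul, embed_conjTranspose, ← hM]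
    calc _ = (circuitMatrix S V * (excitation i).conjTranspose *
          ((circuitMatrix S V).conjTranspose * circuitMatrix S V) * (excitation i) *
            (circuitMatrix S V).conjTranspose).trace := by
          simp only [Matrix.conjTranspose_mul, Matrix.conjTranspose_conjTranspose, mul_assoc]
      _ = ((circuitMatrix S V).conjTranspose * circuitMatrix S V *
          ((excitation i).conjTranspose * excitation i)).trace := by
          rw [conjTranspose_circuitMatrix_mul_self, mul_one, Matrix.trace_mul_comm]
          rw [← conjTranspose_circuitMatrix_mul_self S V]
          simp only [mul_assoc]
      _ = _ := by
          rw [conjTranspose_circuitMatrix_mul_self, one_mul, excitation_conjTranspose_mul_self]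
  have hcard : A.card ≤ n := by simpa using Finset.card_le_univ A
  have h2 := trace_excitation_re_le i
  rw [← h1, trace_embed] at h2
  have h3 : ((M.conjTranspose * M).trace * 2 ^ (n - A.card)).re =
      (M.conjTranspose * M).trace.re * 2 ^ (n - A.card) := by
    rw [← Complex.ofReal_ofNat, ← Complex.ofReal_pow, Complex.re_mul_ofReal]
  have h4 : (2 : ℝ) ^ n = 2 ^ A.card * 2 ^ (n - A.card) := by
    rw [← pow_add, Nat.add_sub_of_le hcard]
  rw [h3, h4] at h2
  exact le_of_mul_le_mul_right h2 (by positivity)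

/-- A state whose local marginals are close to those of the output state of a circuit is close to
this output state. -/
theorem traceNorm_sub_outputState_le {F : Finset (Finset (Fin n))} {k : ℕ}
    (hF : ∀ A ∈ F, A.card ≤ k) (hcone : ∀ i, ∃ A ∈ F, lightCone S.layer i ⊆ A) {ρ : Op n}
    (hρ : IsState ρ) {δ : ℝ}
    (hδ : ∀ A ∈ F, ‖marginal A ρ - marginal A (outputState S V)‖ ≤ δ) :
    traceNorm (ρ - outputState S V) ≤ 2 * √(n * (δ * √(2 ^ k))) := by
  refine (traceNorm_sub_pure_le hρ (star_outputVector_dotProduct_self S V)).trans ?_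
  refine mul_le_mul_of_nonneg_left (Real.sqrt_le_sqrt ?_) zero_le_two
  refine (one_sub_fidelity_le S V hρ).trans ?_
  have hterm : ∀ i, (ρ * parentTerm S V i).trace.re ≤ δ * √(2 ^ k) := by
    intro i
    obtain ⟨A, hA, hi⟩ := hcone i
    obtain ⟨M, hM, hM2⟩ := exists_parentTerm_eq_embed S V hi
    have h0 := trace_outputState_mul_parentTerm S V i
    rw [hM, trace_mul_embed (isState_outputState S V).1] at h0
    have h1 : (ρ * parentTerm S V i).trace =
        -- The output state contributes zero, so its marginal may be subtracted freely.
        ∑ ab, (marginal A ρ - marginal A (outputState S V)) ab * M ab.2 ab.1 := by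
      rw [hM, trace_mul_embed hρ.1, ← sub_zero (∑ ab, marginal A ρ ab * M ab.2 ab.1), ← h0,
        ← Finset.sum_sub_distrib]
      exact Finset.sum_congr rfl fun ab _ => by rw [PiLp.sub_apply]; ring
    rw [h1]
    refine (Complex.re_le_norm _).trans ((norm_sum_mul_le _ M).trans ?_)
    exact mul_le_mul (hδ A hA) (Real.sqrt_le_sqrt
      (hM2.trans (pow_le_pow_right₀ one_le_two (hF A hA)))) (Real.sqrt_nonneg _)
      ((norm_nonneg _).trans (hδ A hA))
  calc _ ≤ ∑ _i : Fin n, δ * √(2 ^ k) := Finset.sum_le_sum fun i _ => hterm i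
    _ = _ := by simp

end Parent

/-! ### The tomography procedure -/

section Tomography

variable {n : ℕ}

/-- The empirical average of the shadows on the qubits in `A`. -/
def empiricalMarginal {N : ℕ} (A : Finset (Fin n)) (ω : Fin N → Record n) : LocalOp A :=
  (N : ℂ)⁻¹ • ∑ t, shadow A (ω t)

-- Concentration for the centred shadows with `c = 2 * 5^(k/2)`. Half of the deviation `N δ` covers
-- the mean norm, which is what `hN` ensures; the other half is the fluctuation `s`.
open Classical in
theorem sum_filter_lt_norm_empiricalMarginal_sub_le {A : Finset (Fin n)} {k : ℕ}
    (hA : A.card ≤ k) {ρ : Op n} (hρ : IsState ρ) {N : ℕ} {δ : ℝ} (hδ : 0 < δ)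
    (hN : 16 * 5 ^ k ≤ N * δ ^ 2) :
    ∑ ω : Fin N → Record n with δ < ‖empiricalMarginal A ω - marginal A ρ‖,
      ∏ t, recordProb ρ (ω t) ≤ Real.exp (-(N * δ ^ 2 / (32 * 5 ^ k))) := by
  have h5 : (0 : ℝ) < 5 ^ k := by positivity
  have hN0 : 0 < N := by
    rcases Nat.eq_zero_or_pos N with h | h
    · rw [h, Nat.cast_zero, zero_mul] at hN
      linarith
    · exact h
  have hNr : (0 : ℝ) < N := Nat.cast_pos.2 hN0
  have hp := fun r => recordProb_nonneg hρ.1 r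
  have hp1 := sum_recordProb hρ
  set c : ℝ := 2 * √(5 ^ k) with hc
  have hc2 : c ^ 2 = 4 * 5 ^ k := by
    rw [hc, mul_pow, Real.sq_sqrt h5.le]
    norm_num
  have hX : ∀ r, ‖shadow A r‖ ≤ √(5 ^ k) := fun r => Real.le_sqrt_of_sq_le (by
    rw [norm_shadow_sq]
    exact pow_le_pow_right₀ (by norm_num) hA)
  have hμ : ‖marginal A ρ‖ ≤ √(5 ^ k) := by
    refine (norm_sum_le _ _).trans ?_
    calc _ ≤ ∑ r, recordProb ρ r * √(5 ^ k) := Finset.sum_le_sum fun r _ => by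
          rw [norm_smul, Complex.norm_real, Real.norm_of_nonneg (hp r)]
          exact mul_le_mul_of_nonneg_left (hX r) (hp r)
      _ = √(5 ^ k) := by rw [← Finset.sum_mul, hp1, one_mul]
  have h0 : ∑ r, (recordProb ρ r : ℂ) • (shadow A r - marginal A ρ) = 0 := by
    simp only [smul_sub, Finset.sum_sub_distrib, ← Finset.sum_smul]
    rw [← Complex.ofReal_sum, hp1, Complex.ofReal_one, one_smul]
    exact sub_self _
  have h := sum_filter_lt_norm_le hp hp1 (Y := fun r => shadow A r - marginal A ρ) (c := c)
    (by positivity)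
    (fun r => (norm_sub_le _ _).trans (by linarith [hX r]))
    (fun r r' => by
      rw [sub_sub_sub_cancel_right]
      exact (norm_sub_le _ _).trans (by linarith [hX r, hX r']))
    h0 hN0 (s := N * δ / 2) (by positivity)
  have he : (N * δ / 2) ^ 2 / (2 * (N * c ^ 2)) = N * δ ^ 2 / (32 * 5 ^ k) := by
    rw [hc2]
    field_simp
    norm_num
  rw [he] at h
  refine (Finset.sum_le_sum_of_subset_of_nonneg (fun ω hω => ?_) fun ω _ _ =>
    Finset.prod_nonneg fun t _ => hp _).trans h
  rw [Finset.mem_filter] at hω ⊢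
  refine ⟨hω.1, ?_⟩
  have hsqrt : √(N * c ^ 2) ≤ N * δ / 2 := by
    rw [Real.sqrt_le_left (by positivity), hc2]
    nlinarith [mul_le_mul_of_nonneg_left hN hNr.le]
  have hsum : ∑ t, (shadow A (ω t) - marginal A ρ) =
      (N : ℂ) • (empiricalMarginal A ω - marginal A ρ) := by
    rw [empiricalMarginal, smul_sub, smul_smul, mul_inv_cancel₀ (by exact_mod_cast hN0.ne'),
      one_smul, Finset.sum_sub_distrib, Finset.sum_const, Finset.card_univ, Fintype.card_fin,
      Nat.cast_smul_eq_nsmul]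
  rw [hsum, norm_smul, Complex.norm_natCast]
  have := mul_lt_mul_of_pos_left hω.2 hNr
  linarith

theorem sum_biUnion_le {ι α : Type*} [DecidableEq α] {f : α → ℝ} (hf : ∀ a, 0 ≤ f a)
    (s : Finset ι) (t : ι → Finset α) :
    ∑ a ∈ s.biUnion t, f a ≤ ∑ i ∈ s, ∑ a ∈ t i, f a := by
  classical
  induction s using Finset.induction_on with
  | empty => simp
  | insert i s hi ih =>
    rw [Finset.biUnion_insert, Finset.sum_insert hi]
    have h := Finset.sum_union_inter (s₁ := t i) (s₂ := s.biUnion t) (f := f)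
    have h0 : 0 ≤ ∑ a ∈ t i ∩ s.biUnion t, f a := Finset.sum_nonneg fun a _ => hf a
    linarith

/-- The projector onto `|0⟩^{⊗ n}`. -/
def zeroState (n : ℕ) : Op n :=
  Matrix.vecMulVec (Pi.single (fun _ => 0) 1) (star (Pi.single (fun _ => 0) 1))

theorem isState_zeroState (n : ℕ) : IsState (zeroState n) :=
  isState_vecMulVec (by simp)

open Classical in
/-- The procedure that returns a state whose marginals on the sets in `F` agree up to `δ` with the
empirical marginals. -/
def shadowLearner (F : Finset (Finset (Fin n))) (δ : ℝ) (N : ℕ) : Learner n N where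
  estimate ω := if h : ∃ ρ : Op n, IsState ρ ∧
      ∀ A ∈ F, ‖empiricalMarginal A ω - marginal A ρ‖ ≤ δ then h.choose else zeroState n
  isState_estimate ω := by
    split_ifs with h
    · exact h.choose_spec.1
    · exact isState_zeroState n

/-- The true state is itself feasible, so the search succeeds, and both states are within `δ` of the
same empirical marginal. -/
theorem norm_marginal_estimate_sub_le {F : Finset (Finset (Fin n))} {δ : ℝ} {N : ℕ}
    {ω : Fin N → Record n} {ρ : Op n} (hρ : IsState ρ)
    (h : ∀ A ∈ F, ‖empiricalMarginal A ω - marginal A ρ‖ ≤ δ) {A : Finset (Fin n)} (hA : A ∈ F) :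
    ‖marginal A ((shadowLearner F δ N).estimate ω) - marginal A ρ‖ ≤ 2 * δ := by
  have hex : ∃ ρ : Op n, IsState ρ ∧ ∀ A ∈ F, ‖empiricalMarginal A ω - marginal A ρ‖ ≤ δ :=
    ⟨ρ, hρ, h⟩
  have he : (shadowLearner F δ N).estimate ω = hex.choose := dif_pos hex
  have h1 := hex.choose_spec.2 A hA
  rw [he, ← sub_sub_sub_cancel_left _ _ (empiricalMarginal A ω)]
  exact (norm_sub_le _ _).trans (by linarith [h A hA])

theorem le_successProb_shadowLearner {F : Finset (Finset (Fin n))} {k m N : ℕ} {ε : ℝ}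
    (hn : 0 < n) (hε : 0 < ε) (hm : 2 ≤ m) (hFm : F.card ≤ m) (hF : ∀ A ∈ F, A.card ≤ k)
    (hN : 24576 * ((n : ℝ) ^ 2 * 10 ^ k * Real.log m / ε ^ 4) ≤ N)
    {D : ℕ} (S : CircuitStructure n D) (V : Gates n D)
    (hcone : ∀ i, ∃ A ∈ F, lightCone S.layer i ⊆ A) :
    2 / 3 ≤ successProb (shadowLearner F (ε ^ 2 / (16 * n * √(2 ^ k))) N) (outputState S V) ε := by
  classical
  have hψ := isState_outputState S V
  set δ : ℝ := ε ^ 2 / (16 * n * √(2 ^ k)) with hδ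
  have hnr : (0 : ℝ) < n := Nat.cast_pos.2 hn
  have h2k : (0 : ℝ) < √(2 ^ k) := by positivity
  have hδ0 : 0 < δ := by positivity
  have hm' : (2 : ℝ) ≤ m := by exact_mod_cast hm
  have hlog : 0.6931471803 < Real.log m :=
    Real.log_two_gt_d9.trans_le (Real.log_le_log two_pos hm')
  have hδ2 : δ ^ 2 = ε ^ 4 / (256 * n ^ 2 * 2 ^ k) := by
    rw [hδ, div_pow, mul_pow, mul_pow, Real.sq_sqrt (by positivity)]
    norm_num
    ring
  -- Here `24576 = 96 * 256`, with `256` from `δ ^ 2`. The `96 = 3 * 32` makes each failure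
  -- probability at most `m⁻³`, so the union bound gives `m⁻² ≤ 1 / 4`.
  have hNδ : 96 * (5 ^ k * Real.log m) ≤ N * δ ^ 2 := by
    have h := mul_le_mul_of_nonneg_right hN (sq_nonneg δ)
    refine le_trans (le_of_eq ?_) h
    have h10 : (10 : ℝ) ^ k = 2 ^ k * 5 ^ k := by
      rw [← mul_pow]
      norm_num
    rw [hδ2, h10]
    field_simp
    norm_num
  have h5 : (0 : ℝ) < 5 ^ k := by positivity
  have hN16 : 16 * 5 ^ k ≤ N * δ ^ 2 := by nlinarith
  have hgood : ∀ ω : Fin N → Record n,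
      (∀ A ∈ F, ‖empiricalMarginal A ω - marginal A (outputState S V)‖ ≤ δ) →
      traceNorm ((shadowLearner F δ N).estimate ω - outputState S V) < ε := by
    intro ω hω
    refine (traceNorm_sub_outputState_le S V hF hcone
      ((shadowLearner F δ N).isState_estimate ω)
      fun A hA => norm_marginal_estimate_sub_le hψ hω hA).trans_lt ?_
    -- The trace distance is then at most `2 * √(ε² / 8) = ε / √2`, strictly below `ε`.
    have h1 : (n : ℝ) * (2 * δ * √(2 ^ k)) = ε ^ 2 / 8 := by
      rw [hδ]
      field_simp
      norm_num
    rw [h1, ← lt_div_iff₀' two_pos, Real.sqrt_lt' (by positivity)]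
    nlinarith [sq_pos_of_pos hε]
  have hp : ∀ ω : Fin N → Record n, 0 ≤ ∏ t, recordProb (outputState S V) (ω t) := fun ω =>
    Finset.prod_nonneg fun t _ => recordProb_nonneg hψ.1 _
  have hbad : ∑ ω : Fin N → Record n with
      ¬ traceNorm ((shadowLearner F δ N).estimate ω - outputState S V) < ε,
        ∏ t, recordProb (outputState S V) (ω t) ≤ 1 / 3 := by
    calc _ ≤ ∑ ω ∈ F.biUnion fun A => Finset.univ.filter fun ω : Fin N → Record n =>
          δ < ‖empiricalMarginal A ω - marginal A (outputState S V)‖,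
          ∏ t, recordProb (outputState S V) (ω t) := by
          refine Finset.sum_le_sum_of_subset_of_nonneg (fun ω hω => ?_) fun ω _ _ => hp ω
          by_contra hω'
          refine (Finset.mem_filter.1 hω).2 (hgood ω fun A hA => ?_)
          by_contra hlt
          exact hω' (Finset.mem_biUnion.2
            ⟨A, hA, Finset.mem_filter.2 ⟨Finset.mem_univ _, not_le.1 hlt⟩⟩)
      _ ≤ ∑ A ∈ F, ∑ ω : Fin N → Record n with
          δ < ‖empiricalMarginal A ω - marginal A (outputState S V)‖,
          ∏ t, recordProb (outputState S V) (ω t) :=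
          sum_biUnion_le hp _ _
      _ ≤ ∑ _A ∈ F, Real.exp (-(N * δ ^ 2 / (32 * 5 ^ k))) := Finset.sum_le_sum fun A hA =>
          sum_filter_lt_norm_empiricalMarginal_sub_le (hF A hA) hψ hδ0 hN16
      _ ≤ m * Real.exp (-(3 * Real.log m)) := by
          rw [Finset.sum_const, nsmul_eq_mul]
          refine mul_le_mul (by exact_mod_cast hFm) (Real.exp_le_exp.2 (neg_le_neg ?_))
            (Real.exp_pos _).le (Nat.cast_nonneg _)
          rw [le_div_iff₀ (by positivity)]
          linarith
      _ = ((m : ℝ) ^ 2)⁻¹ := by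
          have hexp : Real.exp (3 * Real.log m) = (m : ℝ) ^ 3 := by
            rw [mul_comm, Real.exp_mul, Real.exp_log (by linarith)]
            norm_cast
          rw [Real.exp_neg, hexp]
          field_simp
      _ ≤ 1 / 3 := by
          rw [inv_le_comm₀ (by positivity) (by norm_num)]
          nlinarith
  have htotal := Finset.sum_filter_add_sum_filter_not (Finset.univ : Finset (Fin N → Record n))
    (fun ω => traceNorm ((shadowLearner F δ N).estimate ω - outputState S V) < ε)
    (fun ω => ∏ t, recordProb (outputState S V) (ω t))
  rw [sum_prod_eq_one (sum_recordProb hψ)] at htotal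
  have hs : successProb (shadowLearner F δ N) (outputState S V) ε =
      ∑ ω : Fin N → Record n with
        traceNorm ((shadowLearner F δ N).estimate ω - outputState S V) < ε,
          ∏ t, recordProb (outputState S V) (ω t) := by
    rw [successProb]
  rw [hs]
  linarith

theorem traceNorm_zero : traceNorm (0 : Op n) = 0 := by
  have h0 : (0 : Op n).IsHermitian := Matrix.isHermitian_zero
  rw [traceNorm_of_isHermitian h0, h0.eigenvalues_eq_zero_iff.2 rfl]
  simp

/-- For circuits without layers the output state is known. -/
theorem exists_learner_of_depth_zero (n N : ℕ) {ε : ℝ} (hε : 0 < ε) :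
    ∃ A : Learner n N, ∀ (S : CircuitStructure n 0) (V : Gates n 0),
      2 / 3 ≤ successProb A (outputState S V) ε := by
  refine ⟨⟨fun _ => zeroState n, fun _ => isState_zeroState n⟩, fun S V => ?_⟩
  have h : outputState S V = zeroState n := by
    rw [outputState, outputVector, Fin.foldl_zero, zeroState]
  rw [h, successProb, Finset.filter_true_of_mem fun ω _ => by rwa [sub_self, traceNorm_zero],
    sum_prod_eq_one (sum_recordProb (isState_zeroState n))]
  norm_num

theorem locality_pos (g : Geometry) {D : ℕ} (hD : 0 < D) : 0 < g.locality D := by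
  cases g with
  | general => exact Nat.two_pow_pos D
  | chain => exact Nat.mul_pos two_pos hD
  | square =>
    have h : ∀ D, {(0, 0)} ∈ latticeGrowth D := by
      intro D
      induction D with
      | zero => rfl
      | succ D ih => exact ⟨_, ih, id, fun p _ => Or.inl rfl, by simp⟩
    refine lt_of_lt_of_le Nat.zero_lt_one (le_csSup ⟨2 ^ D, ?_⟩ ⟨_, h D, rfl⟩)
    rintro _ ⟨T, hT, rfl⟩
    exact card_le_of_mem_latticeGrowth D T hT

/-- Keeps the logarithm in the sample size bounded away from zero; this is where `k < n` rather than
`k ≤ n` is needed. -/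
theorem two_le_choose {k : ℕ} (hk : 0 < k) (hkn : k < n) : 2 ≤ n.choose k := by
  obtain ⟨n, rfl⟩ := Nat.exists_eq_succ_of_ne_zero (by omega : n ≠ 0)
  obtain ⟨k, rfl⟩ := Nat.exists_eq_succ_of_ne_zero hk.ne'
  rw [Nat.choose_succ_succ]
  have h1 := Nat.choose_pos (n := n) (k := k) (by omega)
  have h2 := Nat.choose_pos (n := n) (k := k + 1) (by omega)
  simp only [Nat.succ_eq_add_one]
  omega

end Tomography

end ShallowTomography

end

/-! ### Both parts of the theorem, by choice of the family of marginals -/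

theorem mainTheorem4 :
    ∃ C : ℝ, 0 < C ∧
      ∀ (g : ShallowTomography.Geometry) (n D N : ℕ) (ε : ℝ), 0 < ε →
        -- unknown circuit structure: one procedure for all circuits
        (g.locality D < n →
          C * ((n : ℝ) ^ 2 * 10 ^ (g.locality D) *
            Real.log (n.choose (g.locality D) : ℝ) / ε ^ 4) ≤ (N : ℝ) →
          ∃ A : ShallowTomography.Learner n N,
            ∀ S : ShallowTomography.CircuitStructure n D, S.IsLocal g →
              ∀ V : ShallowTomography.Gates n D,
                2 / 3 ≤ ShallowTomography.successProb A
                  (ShallowTomography.outputState S V) ε) ∧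
        -- known circuit structure: the procedure may depend on it, but not on the gates
        (2 ≤ n →
          C * ((n : ℝ) ^ 2 * 10 ^ (g.locality D) * Real.log (n : ℝ) / ε ^ 4) ≤ (N : ℝ) →
          ∀ S : ShallowTomography.CircuitStructure n D, S.IsLocal g →
            ∃ A : ShallowTomography.Learner n N,
              ∀ V : ShallowTomography.Gates n D,
                2 / 3 ≤ ShallowTomography.successProb A
                  (ShallowTomography.outputState S V) ε) := by
  refine ⟨24576, by norm_num, fun g n D N ε hε => ?_⟩
  rcases Nat.eq_zero_or_pos D with rfl | hD
  · obtain ⟨A, hA⟩ := ShallowTomography.exists_learner_of_depth_zero n N hε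
    exact ⟨fun _ _ => ⟨A, fun S _ V => hA S V⟩, fun _ _ S _ => ⟨A, fun V => hA S V⟩⟩
  refine ⟨fun hk hN => ?_, fun hn hN S hS => ?_⟩
  · refine ⟨_, fun S hS V => ShallowTomography.le_successProb_shadowLearner
      (F := Finset.powersetCard (g.locality D) Finset.univ) (by omega) hε
      (ShallowTomography.two_le_choose (ShallowTomography.locality_pos g hD) hk)
      (by simp) (fun A hA => (Finset.mem_powersetCard.1 hA).2.le) hN S V fun i => ?_⟩
    -- Without knowledge of the structure, every light cone is still enlarged to some set of exactly
    -- `k` qubits.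
    obtain ⟨A, hiA, hA⟩ := Finset.exists_superset_card_eq
      (ShallowTomography.card_lightCone_le hD S hS i) (by simpa using hk.le)
    exact ⟨A, Finset.mem_powersetCard.2 ⟨Finset.subset_univ A, hA⟩, hiA⟩
  · refine ⟨_, fun V => ShallowTomography.le_successProb_shadowLearner
      (F := Finset.univ.image (ShallowTomography.lightCone S.layer)) (by omega) hε hn
      (Finset.card_image_le.trans (by simp)) (fun A hA => ?_) hN S V fun i =>
        ⟨_, Finset.mem_image_of_mem _ (Finset.mem_univ i), Finset.Subset.rfl⟩⟩
    obtain ⟨i, -, rfl⟩ := Finset.mem_image.1 hA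
    exact ShallowTomography.card_lightCone_le hD S hS i
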